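/- Let $\Bbbk$ be any field (no restriction on the characteristic) and let $n\ge 1$. **The category $Web(SL_n^-)$.** This is the $\Bbbk$-linear strict monoidal category whose objects are the finite sequences in $\{1,\dots,n\}$ (tensor product: concatenation), whose morphisms are generated by trivalent vertices $(j,k)\to(j+k)$ (merge) and $(j+k)\to(j,k)$ (split) for $j,k\ge1$, $j+k\le n$, and univalent vertices $(n)\to\emptyset$ and $\emptyset\to(n)$, subject to the following relations. (1) Merges are associative and splits are coassociative. (2) Bigon bursting: the split $(j+k)\to(j,k)$ followed by the merge $(j,k)\to(j+k)$ is $\binom{j+k}{j}$ times the identity. (3) Square switch relations. Let $F^{(r)}\colon(a,b)\to(a-r,b+r)$ be the web that splits off a strand labelled $r$ from the left upright and merges it into the right one, and let $E^{(r)}\colon(a,b)\to(a+r,b-r)$ be its mirror image. Then on $(m,\ell)$ $$E^{(j)}F^{(k)}=\sum_t\binom{m-\ell+j-k}{t}F^{(k-t)}E^{(j-t)},\qquad F^{(j)}E^{(k)}=\sum_t\binom{\ell-m+j-k}{t}E^{(k-t)}F^{(j-t)},$$ where $0\le t\le\min(j,k)$, binomial coefficients are the generalized ones $\binom{x}{t}=x(x-1)\cdots(x-t+1)/t!$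 for $x\in\mathbb Z$, strands labelled $0$ are erased, and webs with a label that is negative or larger than $n$ are zero. (4) The two univalent vertices are mutually inverse. (5) For $1\le m\le n-1$, let $\mathrm{cup}_{a,b}\colon\emptyset\to(n)\to(a,b)$ and $\mathrm{cap}_{a,b}\colon(a,b)\to(n)\to\emptyset$ ($a+b=n$) be the composites of univalent and trivalent vertices. Then $$\mathrm{id}_m=(\mathrm{cap}_{m,n-m}\otimes\mathrm{id}_m)(\mathrm{id}_m\otimes\mathrm{cup}_{n-m,m})=(\mathrm{id}_m\otimes\mathrm{cap}_{n-m,m})(\mathrm{cup}_{m,n-m}\otimes\mathrm{id}_m).$$ **The graph planar algebra.** Let $\Gamma$ be the $sl_n$ weight lattice $\mathbb Z\{L_1,\dots,L_n\}/(L_1+\dots+L_n)$, viewed as a directed graph with an edge from $x$ to $x+\sum_{i\in A}L_i$ labelled $|A|$ for every proper nonempty subset $A\subset\{1,\dots,n\}$. The category $G(\Gamma)$ over $\Bbbk$ has as objects the finite sequences of edge labels. A morphism $\sigma\to\tau$ is a $\Bbbk$-valued function on pairs $(p,q)$ of paths in $\Gamma$ with edge labels $\sigma$ and $\tau$ respectively,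 vanishing unless $p$ and $q$ match, i.e. have the same starting point and the same end point. Composition is $(g\circ f)(p,q)=\sum_{r}f(p,r)\,g(r,q)$, the sum being over the paths $r$ of the intermediate type that match $p$ (equivalently $q$). The tensor product is concatenation on objects and $(f\otimes g)(p_1p_2,q_1q_2)=f(p_1,q_1)\,g(p_2,q_2)$ on morphisms. This is a $\Bbbk$-linear strict monoidal category. **Theorem.** There is a $\Bbbk$-linear strict monoidal functor $Web(SL_n^-)\to G(\Gamma)$ which sends a sequence in $\{1,\dots,n\}$ to the sequence obtained by replacing every entry $n$ by the empty sequence, and which sends every generating trivalent or univalent vertex to the indicator function of cycles: its value on a matched pair $(p,q)$ is $1$ if following $p$ and returning along $q$ is a cycle (it visits no vertex twice; for two paths of length $0$ at the same vertex this always holds), and $0$ otherwise. -/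

import Mathlib

open CategoryTheory

universe u v w

/-! ## Graph planar algebras -/

/-- A locally finite directed graph on the vertex set `V` whose edges carry labels in `L`:
`Edge x y l` says that there is an edge `x ⟶ y` labelled `l`. -/
structure LabeledGraph (V : Type v) (L : Type w) where
  Edge : V → V → L → Prop
  locallyFinite : ∀ x l, {y | Edge x y l}.Finite

namespace LabeledGraph

variable {V : Type v} {L : Type w}

/-- `Γ.IsWalk x σ vs`: the vertices `vs` are, in order, the vertices visited after `x` by a walk
that starts at `x` and whose successive edges are labelled by the entries of `σ`. -/
def IsWalk (Γ : LabeledGraph V L) : V → List L → List V → Prop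
  | _, [], [] => True
  | x, l :: σ, y :: ys => Γ.Edge x y l ∧ Γ.IsWalk y σ ys
  | _, [], _ :: _ => False
  | _, _ :: _, [] => False

/-- Paths of type `σ` in `Γ`. -/
@[ext]
structure Path (Γ : LabeledGraph V L) (σ : List L) where
  src : V
  rest : List V
  isWalk : Γ.IsWalk src σ rest

theorem IsWalk.length_eq {Γ : LabeledGraph V L} : ∀ {x : V} {σ : List L} {vs : List V},
    Γ.IsWalk x σ vs → vs.length = σ.length
  | _, [], [], _ => rfl
  | _, _ :: _, _ :: _, h => by simpa using IsWalk.length_eq h.2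
  | _, [], _ :: _, h => h.elim
  | _, _ :: _, [], h => h.elim

theorem isWalk_append {Γ : LabeledGraph V L} {τ : List L} : ∀ {x : V} {σ : List L} {vs : List V},
    Γ.IsWalk x (σ ++ τ) vs ↔ Γ.IsWalk x σ (vs.take σ.length) ∧
      Γ.IsWalk ((vs.take σ.length).getLastD x) τ (vs.drop σ.length)
  | x, [], vs => by simp [IsWalk]
  | x, l :: σ, [] => by simp [IsWalk]
  | x, l :: σ, y :: ys => by
      have := isWalk_append (Γ := Γ) (τ := τ) (x := y) (σ := σ) (vs := ys)
      simp only [List.cons_append, IsWalk, this, List.length_cons, List.take_succ_cons,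
        List.drop_succ_cons, List.getLastD_cons, and_assoc]

theorem finite_isWalk (Γ : LabeledGraph V L) : ∀ (σ : List L) (x : V),
    {vs | Γ.IsWalk x σ vs}.Finite
  | [], x => by
      refine (Set.finite_singleton ([] : List V)).subset ?_
      rintro (_ | ⟨y, ys⟩) h
      · simp
      · exact h.elim
  | l :: σ, x => by
      refine ((Γ.locallyFinite x l).biUnion
        (t := fun y => List.cons y '' {vs | Γ.IsWalk y σ vs})
        fun y _ => (finite_isWalk Γ σ y).image _).subset ?_
      rintro (_ | ⟨y, ys⟩) h
      · exact h.elim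
      · simp only [Set.mem_iUnion]
        exact ⟨y, h.1, ys, h.2, rfl⟩

namespace Path

variable {Γ : LabeledGraph V L} {σ τ ρ : List L}

/-- The end point of a path. -/
def tgt (p : Γ.Path σ) : V := p.rest.getLastD p.src

/-- The list of all vertices of a path, in order. -/
def verts (p : Γ.Path σ) : List V := p.src :: p.rest

/-- Two paths match if their starting points and their end points coincide. -/
def Matched (p : Γ.Path σ) (q : Γ.Path τ) : Prop := p.src = q.src ∧ p.tgt = q.tgt

theorem Matched.symm {p : Γ.Path σ} {q : Γ.Path τ} (h : p.Matched q) : q.Matched p :=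
  ⟨h.1.symm, h.2.symm⟩

theorem Matched.trans {p : Γ.Path σ} {q : Γ.Path τ} {r : Γ.Path ρ} (h : p.Matched q)
    (h' : q.Matched r) : p.Matched r :=
  ⟨h.1.trans h'.1, h.2.trans h'.2⟩

/-- The initial segment of type `σ` of a path of type `σ ++ τ`. -/
def left (σ τ : List L) (p : Γ.Path (σ ++ τ)) : Γ.Path σ :=
  ⟨p.src, p.rest.take σ.length, (isWalk_append.1 p.isWalk).1⟩

/-- The final segment of type `τ` of a path of type `σ ++ τ`. -/
def right (σ τ : List L) (p : Γ.Path (σ ++ τ)) : Γ.Path τ :=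
  ⟨(p.left σ τ).tgt, p.rest.drop σ.length, (isWalk_append.1 p.isWalk).2⟩

/-- Concatenation of paths. -/
def append (p : Γ.Path σ) (q : Γ.Path τ) (h : p.tgt = q.src) : Γ.Path (σ ++ τ) :=
  ⟨p.src, p.rest ++ q.rest, by
    have hl : p.rest.length = σ.length := p.isWalk.length_eq
    refine isWalk_append.2 ⟨?_, ?_⟩
    · rw [← hl, List.take_left]; exact p.isWalk
    · rw [← hl, List.take_left, List.drop_left]
      have : p.rest.getLastD p.src = q.src := h
      rw [this]; exact q.isWalk⟩

theorem left_append (p : Γ.Path σ) (q : Γ.Path τ) (h : p.tgt = q.src) :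
    (p.append q h).left σ τ = p := by
  have hl : p.rest.length = σ.length := p.isWalk.length_eq
  ext1
  · rfl
  · simp [left, append, ← hl]

theorem right_append (p : Γ.Path σ) (q : Γ.Path τ) (h : p.tgt = q.src) :
    (p.append q h).right σ τ = q := by
  have hl : p.rest.length = σ.length := p.isWalk.length_eq
  ext1
  · change ((p.append q h).left σ τ).tgt = _
    rw [left_append, h]
  · simp [right, append, ← hl]

theorem eq_of_left_right {p q : Γ.Path (σ ++ τ)} (h : p.left σ τ = q.left σ τ)
    (h' : p.right σ τ = q.right σ τ) : p = q := by
  ext1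
  · exact congrArg (Path.src (Γ := Γ) (σ := σ)) h
  · have h1 : p.rest.take σ.length = q.rest.take σ.length := congrArg (Path.rest (Γ := Γ)) h
    have h2 : p.rest.drop σ.length = q.rest.drop σ.length := congrArg (Path.rest (Γ := Γ)) h'
    rw [← List.take_append_drop σ.length p.rest, h1, h2, List.take_append_drop]

theorem tgt_right (p : Γ.Path (σ ++ τ)) : (p.right σ τ).tgt = p.tgt := by
  change (p.rest.drop _).getLastD ((p.rest.take _).getLastD p.src) = p.rest.getLastD p.src
  conv_rhs => rw [← List.take_append_drop σ.length p.rest]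
  simp only [List.getLastD_eq_getLast?, List.getLast?_append]
  cases (List.drop σ.length p.rest).getLast? <;> simp

theorem matched_of_left_right {σ' τ' : List L} {p : Γ.Path (σ ++ τ)} {q : Γ.Path (σ' ++ τ')}
    (h : (p.left σ τ).Matched (q.left σ' τ')) (h' : (p.right σ τ).Matched (q.right σ' τ')) :
    p.Matched q :=
  ⟨h.1, by rw [← tgt_right, ← tgt_right]; exact h'.2⟩

theorem finite_matched (p : Γ.Path σ) (τ : List L) : {q : Γ.Path τ | p.Matched q}.Finite := by
  refine Set.Finite.of_finite_image (f := Path.rest)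
    ((Γ.finite_isWalk τ p.src).subset ?_) ?_
  · rintro _ ⟨q, hq, rfl⟩
    have h : p.src = q.src := hq.1
    change Γ.IsWalk p.src τ q.rest
    rw [h]; exact q.isWalk
  · intro q hq r hr h
    exact Path.ext (hq.1.symm.trans hr.1) h

/-- The finite set of all paths of type `τ` that match `p`. -/
noncomputable def matching (p : Γ.Path σ) (τ : List L) : Finset (Γ.Path τ) :=
  (p.finite_matched τ).toFinset

theorem mem_matching {p : Γ.Path σ} {q : Γ.Path τ} : q ∈ p.matching τ ↔ p.Matched q := by
  simp [matching]

/-- Two matched paths bound a cycle if the closed walk that follows the first path and returns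
along the second one visits no vertex twice. (If both paths have length `0` and are equal,
this always holds.) -/
def BoundsCycle (p : Γ.Path σ) (q : Γ.Path τ) : Prop :=
  p.Matched q ∧ (p.verts.dropLast ++ q.verts.tail.reverse).Nodup

end Path

end LabeledGraph

/-- The graph planar algebra `G(Γ)` over `k`: its objects are finite sequences of edge labels. -/
@[ext]
structure GPA (k : Type u) {V : Type v} {L : Type w} (Γ : LabeledGraph V L) where
  seq : List L

namespace GPA

variable {k : Type u} {V : Type v} {L : Type w} {Γ : LabeledGraph V L}

/-- The tensor product of two objects: concatenation of sequences. -/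
def tensorObj (X Y : GPA k Γ) : GPA k Γ := ⟨X.seq ++ Y.seq⟩

theorem tensorObj_assoc (X Y Z : GPA k Γ) :
    tensorObj (tensorObj X Y) Z = tensorObj X (tensorObj Y Z) :=
  congrArg mk (List.append_assoc _ _ _)

theorem tensorObj_nil (X : GPA k Γ) : tensorObj X ⟨[]⟩ = X :=
  congrArg mk (List.append_nil _)

theorem nil_tensorObj (X : GPA k Γ) : tensorObj ⟨[]⟩ X = X := rfl

variable [Field k]

/-- A morphism `X ⟶ Y`: a `k`-valued function on pairs of paths of types `X` and `Y` (that is, a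
linear functional on the vector space freely spanned by these pairs) that vanishes on the
pairs that do not match. -/
@[ext]
structure Hom (X Y : GPA k Γ) where
  toFun : Γ.Path X.seq → Γ.Path Y.seq → k
  vanish : ∀ p q, ¬ p.Matched q → toFun p q = 0

open Classical in
/-- The identity morphism. -/
noncomputable def Hom.id (X : GPA k Γ) : Hom X X where
  toFun p q := if p = q then 1 else 0
  vanish p q h := if_neg fun e => h (by subst e; exact ⟨rfl, rfl⟩)

/-- Composition: the sum over all matching paths of the intermediate type. -/
noncomputable def Hom.comp {X Y Z : GPA k Γ} (f : Hom X Y) (g : Hom Y Z) : Hom X Z where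
  toFun p q := ∑ r ∈ p.matching Y.seq, f.toFun p r * g.toFun r q
  vanish p q h := Finset.sum_eq_zero fun r hr => by
    rw [g.vanish r q fun h' => h ((LabeledGraph.Path.mem_matching.1 hr).trans h'), mul_zero]

theorem Hom.id_comp {X Y : GPA k Γ} (f : Hom X Y) : (Hom.id X).comp f = f := by
  classical
  ext p q
  refine (Finset.sum_eq_single p ?_ ?_).trans ?_
  · intro r _ h
    simp [Hom.id, h.symm]
  · intro h
    exact (h (LabeledGraph.Path.mem_matching.2 ⟨rfl, rfl⟩)).elim
  · simp [Hom.id]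

theorem Hom.comp_id {X Y : GPA k Γ} (f : Hom X Y) : f.comp (Hom.id Y) = f := by
  classical
  ext p q
  refine (Finset.sum_eq_single q ?_ ?_).trans ?_
  · intro r _ h
    simp [Hom.id, h]
  · intro h
    rw [f.vanish p q fun h' => h (LabeledGraph.Path.mem_matching.2 h'), zero_mul]
  · simp [Hom.id]

theorem Hom.comp_assoc {X Y Z W : GPA k Γ} (f : Hom X Y) (g : Hom Y Z) (h : Hom Z W) :
    (f.comp g).comp h = f.comp (g.comp h) := by
  ext p q
  simp only [Hom.comp, Finset.sum_mul, Finset.mul_sum]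
  rw [Finset.sum_comm]
  refine Finset.sum_congr rfl fun r hr => ?_
  have hr' := LabeledGraph.Path.mem_matching.1 hr
  refine Finset.sum_congr ?_ fun s _ => mul_assoc _ _ _
  ext s
  rw [LabeledGraph.Path.mem_matching, LabeledGraph.Path.mem_matching]
  exact ⟨fun h => hr'.symm.trans h, fun h => hr'.trans h⟩

noncomputable instance : Category (GPA k Γ) where
  Hom := Hom
  id := Hom.id
  comp := Hom.comp
  id_comp := Hom.id_comp
  comp_id := Hom.comp_id
  assoc := Hom.comp_assoc

@[ext]
theorem hom_ext {X Y : GPA k Γ} {f g : X ⟶ Y} (h : ∀ p q, f.toFun p q = g.toFun p q) : f = g :=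
  Hom.ext (funext fun p => funext fun q => h p q)

theorem comp_toFun {X Y Z : GPA k Γ} (f : X ⟶ Y) (g : Y ⟶ Z) (p : Γ.Path X.seq)
    (q : Γ.Path Z.seq) :
    (f ≫ g).toFun p q = ∑ r ∈ p.matching Y.seq, f.toFun p r * g.toFun r q := rfl

/-! ### The linear structure (pointwise) -/

instance (X Y : GPA k Γ) : Zero (X ⟶ Y) := ⟨⟨fun _ _ => 0, fun _ _ _ => rfl⟩⟩
instance (X Y : GPA k Γ) : Add (X ⟶ Y) :=
  ⟨fun f g => ⟨fun p q => f.toFun p q + g.toFun p q, fun p q h => by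
    rw [f.vanish p q h, g.vanish p q h, add_zero]⟩⟩
instance (X Y : GPA k Γ) : Neg (X ⟶ Y) :=
  ⟨fun f => ⟨fun p q => - f.toFun p q, fun p q h => by rw [f.vanish p q h, neg_zero]⟩⟩
instance (X Y : GPA k Γ) : SMul k (X ⟶ Y) :=
  ⟨fun c f => ⟨fun p q => c * f.toFun p q, fun p q h => by rw [f.vanish p q h, mul_zero]⟩⟩

@[simp] theorem zero_toFun {X Y : GPA k Γ} (p : Γ.Path X.seq) (q : Γ.Path Y.seq) :
    (0 : X ⟶ Y).toFun p q = 0 := rfl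
@[simp] theorem add_toFun {X Y : GPA k Γ} (f g : X ⟶ Y) (p : Γ.Path X.seq) (q : Γ.Path Y.seq) :
    (f + g).toFun p q = f.toFun p q + g.toFun p q := rfl
@[simp] theorem neg_toFun {X Y : GPA k Γ} (f : X ⟶ Y) (p : Γ.Path X.seq) (q : Γ.Path Y.seq) :
    (-f).toFun p q = - f.toFun p q := rfl
@[simp] theorem smul_toFun {X Y : GPA k Γ} (c : k) (f : X ⟶ Y) (p : Γ.Path X.seq)
    (q : Γ.Path Y.seq) : (c • f).toFun p q = c * f.toFun p q := rfl

instance (X Y : GPA k Γ) : AddCommGroup (X ⟶ Y) where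
  add_assoc f g h := by ext; simp [add_assoc]
  zero_add f := by ext; simp
  add_zero f := by ext; simp
  add_comm f g := by ext; simp [add_comm]
  neg_add_cancel f := by ext; simp
  nsmul := nsmulRec
  zsmul := zsmulRec

instance (X Y : GPA k Γ) : Module k (X ⟶ Y) where
  one_smul f := by ext; simp
  mul_smul a b f := by ext; simp [mul_assoc]
  smul_zero a := by ext; simp
  smul_add a f g := by ext; simp [mul_add]
  add_smul a b f := by ext; simp [add_mul]
  zero_smul f := by ext; simp

instance : Preadditive (GPA k Γ) where
  add_comp X Y Z f f' g := by ext; simp [comp_toFun, add_mul, Finset.sum_add_distrib]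
  comp_add X Y Z f g g' := by ext; simp [comp_toFun, mul_add, Finset.sum_add_distrib]

instance : Linear k (GPA k Γ) where
  smul_comp X Y Z r f g := by ext; simp [comp_toFun, Finset.mul_sum, mul_assoc]
  comp_smul X Y Z f r g := by
    ext; simp only [comp_toFun, smul_toFun, Finset.mul_sum, mul_left_comm]

/-! ### The monoidal structure -/

/-- The tensor product of two morphisms. -/
def tensorHom {X Y X' Y' : GPA k Γ} (f : X ⟶ Y) (g : X' ⟶ Y') :
    tensorObj X X' ⟶ tensorObj Y Y' where
  toFun p q := f.toFun (p.left X.seq X'.seq) (q.left Y.seq Y'.seq) *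
    g.toFun (p.right X.seq X'.seq) (q.right Y.seq Y'.seq)
  vanish p q h := by
    by_cases h1 : (p.left X.seq X'.seq).Matched (q.left Y.seq Y'.seq)
    · rw [g.vanish _ _ fun h2 => h (LabeledGraph.Path.matched_of_left_right h1 h2), mul_zero]
    · rw [f.vanish _ _ h1, zero_mul]

theorem tensorHom_id (X Y : GPA k Γ) : tensorHom (𝟙 X) (𝟙 Y) = 𝟙 (tensorObj X Y) := by
  classical
  apply hom_ext
  intro p q
  change (if _ then (1 : k) else 0) * (if _ then 1 else 0) = if _ then 1 else 0
  by_cases h : p = q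
  · simp [h]
  · by_cases h1 : p.left X.seq Y.seq = q.left X.seq Y.seq
    · have h2 : p.right X.seq Y.seq ≠ q.right X.seq Y.seq := fun h2 =>
        h (LabeledGraph.Path.eq_of_left_right h1 h2)
      rw [if_neg h2, if_neg h, mul_zero]
    · rw [if_neg h1, if_neg h, zero_mul]

theorem tensorHom_comp {X Y Z X' Y' Z' : GPA k Γ} (f : X ⟶ Y) (g : Y ⟶ Z) (f' : X' ⟶ Y')
    (g' : Y' ⟶ Z') : tensorHom (f ≫ g) (f' ≫ g') = tensorHom f f' ≫ tensorHom g g' := by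
  classical
  apply hom_ext
  intro p q
  change (∑ r ∈ (p.left X.seq X'.seq).matching Y.seq, _) *
    (∑ s ∈ (p.right X.seq X'.seq).matching Y'.seq, _) =
    ∑ t ∈ p.matching (Y.seq ++ Y'.seq), _
  rw [Finset.sum_mul_sum, ← Finset.sum_product']
  symm
  refine Finset.sum_bij_ne_zero
    (fun (t : Γ.Path (Y.seq ++ Y'.seq)) _ _ => (t.left Y.seq Y'.seq, t.right Y.seq Y'.seq))
    ?_ ?_ ?_ ?_
  · intro t ht h0
    simp only [Finset.mem_product, LabeledGraph.Path.mem_matching]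
    constructor
    · by_contra h
      exact h0 (by simp only [tensorHom, f.vanish _ _ h, zero_mul])
    · by_contra h
      exact h0 (by simp only [tensorHom, f'.vanish _ _ h, mul_zero, zero_mul])
  · intro t _ _ t' _ _ h
    exact LabeledGraph.Path.eq_of_left_right (Prod.ext_iff.1 h).1 (Prod.ext_iff.1 h).2
  · rintro ⟨r, s⟩ hrs h0
    simp only [Finset.mem_product, LabeledGraph.Path.mem_matching] at hrs
    have hc : r.tgt = s.src := hrs.1.2.symm.trans hrs.2.1
    have hl := LabeledGraph.Path.left_append r s hc
    have hr := LabeledGraph.Path.right_append r s hc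
    refine ⟨r.append s hc, ?_, ?_, Prod.ext hl hr⟩
    · rw [LabeledGraph.Path.mem_matching]
      exact LabeledGraph.Path.matched_of_left_right (by rw [hl]; exact hrs.1)
        (by rw [hr]; exact hrs.2)
    · refine fun h => h0 (Eq.trans ?_ h)
      simp only [tensorHom, hl, hr]
      ring
  · intro t _ _
    simp only [tensorHom]
    ring

/-- A path, regarded as a path of an equal type. -/
def castPath {σ τ : List L} (h : σ = τ) (p : Γ.Path σ) : Γ.Path τ :=
  ⟨p.src, p.rest, h ▸ p.isWalk⟩

theorem comp_eqToHom_toFun {X Y Z : GPA k Γ} (f : X ⟶ Y) (h : Y = Z) (p : Γ.Path X.seq)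
    (q : Γ.Path Z.seq) :
    (f ≫ eqToHom h).toFun p q = f.toFun p (castPath (congrArg seq h.symm) q) := by
  subst h
  rw [eqToHom_refl, Category.comp_id]
  rfl

theorem eqToHom_comp_toFun {X Y Z : GPA k Γ} (h : X = Y) (f : Y ⟶ Z) (p : Γ.Path X.seq)
    (q : Γ.Path Z.seq) :
    (eqToHom h ≫ f).toFun p q = f.toFun (castPath (congrArg seq h) p) q := by
  subst h
  rw [eqToHom_refl, Category.id_comp]
  rfl

theorem tensorHom_eqToHom {X Y X' Y' : GPA k Γ} (h : X = Y) (h' : X' = Y') :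
    tensorHom (eqToHom h) (eqToHom h') = eqToHom (by rw [h, h']) := by
  subst h h'
  exact tensorHom_id _ _

theorem tensorHom_assoc {X Y Z X' Y' Z' : GPA k Γ} (f : X ⟶ X') (g : Y ⟶ Y') (h : Z ⟶ Z') :
    tensorHom (tensorHom f g) h ≫ eqToHom (tensorObj_assoc X' Y' Z') =
      eqToHom (tensorObj_assoc X Y Z) ≫ tensorHom f (tensorHom g h) := by
  apply hom_ext
  intro p q
  rw [comp_eqToHom_toFun, eqToHom_comp_toFun]
  have key : ∀ (A B C : GPA k Γ) (r : Γ.Path ((A.seq ++ B.seq) ++ C.seq))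
      (r' : Γ.Path (A.seq ++ (B.seq ++ C.seq))), r.src = r'.src → r.rest = r'.rest →
      (r.left (A.seq ++ B.seq) C.seq).left A.seq B.seq = r'.left A.seq (B.seq ++ C.seq) ∧
      (r.left (A.seq ++ B.seq) C.seq).right A.seq B.seq =
        (r'.right A.seq (B.seq ++ C.seq)).left B.seq C.seq ∧
      r.right (A.seq ++ B.seq) C.seq = (r'.right A.seq (B.seq ++ C.seq)).right B.seq C.seq := by
    rintro A B C ⟨x, vs, hv⟩ ⟨x', vs', hv'⟩ rfl rfl
    have h1 : (LabeledGraph.Path.left (A.seq ++ B.seq) C.seq ⟨x, vs, hv⟩).left A.seq B.seq =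
        LabeledGraph.Path.left A.seq (B.seq ++ C.seq) ⟨x, vs, hv'⟩ := by
      ext1
      · rfl
      · simp [LabeledGraph.Path.left, List.take_take]
    have h2 : (LabeledGraph.Path.left (A.seq ++ B.seq) C.seq ⟨x, vs, hv⟩).right A.seq B.seq =
        (LabeledGraph.Path.right A.seq (B.seq ++ C.seq) ⟨x, vs, hv'⟩).left B.seq C.seq := by
      ext1
      · exact congrArg LabeledGraph.Path.tgt h1
      · simp [LabeledGraph.Path.left, LabeledGraph.Path.right, List.drop_take]
    refine ⟨h1, h2, ?_⟩
    ext1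
    · have := congrArg LabeledGraph.Path.tgt h2
      rw [LabeledGraph.Path.tgt_right] at this
      exact this
    · simp [LabeledGraph.Path.right, List.drop_drop]
  obtain ⟨hp1, hp2, hp3⟩ := key X Y Z p (castPath (congrArg seq (tensorObj_assoc X Y Z)) p) rfl rfl
  obtain ⟨hq1, hq2, hq3⟩ := key X' Y' Z'
    (castPath (congrArg seq (tensorObj_assoc X' Y' Z').symm) q) q rfl rfl
  simp only [tensorHom, tensorObj] at hp1 hp2 hp3 hq1 hq2 hq3 ⊢
  rw [hp1, hp2, hp3, hq1, hq2, hq3, mul_assoc]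

theorem id_nil_toFun (p q : Γ.Path (⟨[]⟩ : GPA k Γ).seq) (h : p.src = q.src) :
    Hom.toFun (𝟙 (⟨[]⟩ : GPA k Γ)) p q = 1 := by
  refine if_pos (LabeledGraph.Path.ext h ?_)
  rw [List.eq_nil_of_length_eq_zero p.isWalk.length_eq,
    List.eq_nil_of_length_eq_zero q.isWalk.length_eq]

theorem tensorHom_unit_right {X Y : GPA k Γ} (f : X ⟶ Y) :
    tensorHom f (𝟙 (⟨[]⟩ : GPA k Γ)) ≫ eqToHom (tensorObj_nil Y) =
      eqToHom (tensorObj_nil X) ≫ f := by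
  apply hom_ext
  intro p q
  rw [comp_eqToHom_toFun, eqToHom_comp_toFun]
  have key : ∀ (A : GPA k Γ) (r : Γ.Path (A.seq ++ [])) (r' : Γ.Path A.seq), r.src = r'.src →
      r.rest = r'.rest → r.left A.seq [] = r' := by
    rintro A ⟨x, vs, hv⟩ ⟨x', vs', hv'⟩ rfl rfl
    ext1
    · rfl
    · simp [LabeledGraph.Path.left, ← hv'.length_eq]
  have hp := key X p (castPath (congrArg seq (tensorObj_nil X)) p) rfl rfl
  have hq := key Y (castPath (congrArg seq (tensorObj_nil Y).symm) q) q rfl rfl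
  simp only [tensorHom]
  by_cases h : (p.left X.seq []).Matched
      ((castPath (congrArg seq (tensorObj_nil Y).symm) q).left Y.seq [])
  · exact (congrArg₂ (· * ·) (congrArg₂ f.toFun hp hq) (id_nil_toFun _ _ h.2)).trans (mul_one _)
  · refine (congrArg (· * _) (f.vanish _ _ h)).trans ((zero_mul _).trans ?_)
    exact ((congrArg₂ f.toFun hp hq).symm.trans (f.vanish _ _ h)).symm

theorem tensorHom_unit_left {X Y : GPA k Γ} (f : X ⟶ Y) :
    tensorHom (𝟙 (⟨[]⟩ : GPA k Γ)) f ≫ eqToHom (nil_tensorObj Y) =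
      eqToHom (nil_tensorObj X) ≫ f := by
  refine (Category.comp_id _).trans (Eq.trans ?_ (Category.id_comp _).symm)
  apply hom_ext
  intro p q
  change Hom.toFun (𝟙 (⟨[]⟩ : GPA k Γ)) _ _ * f.toFun p q = f.toFun p q
  by_cases h : p.src = q.src
  · rw [id_nil_toFun _ _ (by exact h), one_mul]
  · rw [f.vanish p q fun h' => h h'.1, mul_zero]

theorem pentagon_aux (W X Y Z : GPA k Γ) :
    tensorHom (eqToHom (tensorObj_assoc W X Y)) (𝟙 Z) ≫
        eqToHom (tensorObj_assoc W (tensorObj X Y) Z) ≫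
          tensorHom (𝟙 W) (eqToHom (tensorObj_assoc X Y Z)) =
      eqToHom (tensorObj_assoc (tensorObj W X) Y Z) ≫
        eqToHom (tensorObj_assoc W X (tensorObj Y Z)) := by
  rw [← eqToHom_refl Z rfl, ← eqToHom_refl W rfl]
  simp only [tensorHom_eqToHom, eqToHom_trans]

theorem triangle_aux (X Y : GPA k Γ) :
    eqToHom (tensorObj_assoc X ⟨[]⟩ Y) ≫ tensorHom (𝟙 X) (eqToHom (nil_tensorObj Y)) =
      tensorHom (eqToHom (tensorObj_nil X)) (𝟙 Y) := by
  rw [← eqToHom_refl Y rfl, ← eqToHom_refl X rfl]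
  simp only [tensorHom_eqToHom, eqToHom_trans]

noncomputable instance : MonoidalCategoryStruct (GPA k Γ) where
  tensorObj := tensorObj
  tensorHom := tensorHom
  whiskerLeft X _ _ f := tensorHom (𝟙 X) f
  whiskerRight f Y := tensorHom f (𝟙 Y)
  tensorUnit := ⟨[]⟩
  associator X Y Z := eqToIso (tensorObj_assoc X Y Z)
  leftUnitor X := eqToIso (nil_tensorObj X)
  rightUnitor X := eqToIso (tensorObj_nil X)

noncomputable instance : MonoidalCategory (GPA k Γ) :=
  MonoidalCategory.ofTensorHom
    (id_tensorHom_id := tensorHom_id)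
    (id_tensorHom := fun _ _ _ _ => rfl)
    (tensorHom_id := fun _ _ => rfl)
    (tensorHom_comp_tensorHom := fun f g h i => (tensorHom_comp f h g i).symm)
    (associator_naturality := tensorHom_assoc)
    (leftUnitor_naturality := tensorHom_unit_left)
    (rightUnitor_naturality := tensorHom_unit_right)
    (pentagon := pentagon_aux)
    (triangle := triangle_aux)

open Classical in
/-- The triangle indicator map between two objects: it takes the value `1` on a matched pair of
paths whose concatenation is a cycle, and `0` on all other pairs. -/
noncomputable def triangle (X Y : GPA k Γ) : X ⟶ Y where
  toFun p q := if p.BoundsCycle q then 1 else 0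
  vanish _ _ h := if_neg fun h' => h h'.1

end GPA

/-! ## The weight lattice of `sl_n` as a labelled graph -/

/-- The weight lattice of `sl_n`: the free abelian group on `L_1, …, L_n` modulo
`L_1 + ⋯ + L_n`. -/
abbrev WeightLattice (n : ℕ) : Type :=
  (Fin n → ℤ) ⧸ AddSubgroup.zmultiples (fun _ : Fin n => (1 : ℤ))

/-- The weight `∑_{i ∈ A} L_i` attached to a subset `A` of `{1, …, n}`. -/
def subsetWeight (n : ℕ) (A : Finset (Fin n)) : WeightLattice n :=
  QuotientAddGroup.mk' _ (∑ i ∈ A, Pi.single i 1)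

/-- The possible edge labels `1, …, n - 1`. -/
abbrev EdgeLabel (n : ℕ) : Type := {a : ℕ // 1 ≤ a ∧ a < n}

/-- The `sl_n` weight lattice as a labelled graph: there is an edge from `x` to `y` labelled `l`
if `y = x + ∑_{i ∈ A} L_i` for a (nonempty proper) subset `A` of `{1, …, n}` with `l` elements. -/
def weightGraph (n : ℕ) : LabeledGraph (WeightLattice n) (EdgeLabel n) where
  Edge x y l := ∃ A : Finset (Fin n), A.card = l.1 ∧ y = x + subsetWeight n A
  locallyFinite x l := by
    refine (Set.finite_range fun A : Finset (Fin n) => x + subsetWeight n A).subset ?_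
    rintro y ⟨A, -, rfl⟩
    exact ⟨A, rfl⟩

/-! ## The category `Web(SL_n^-)` -/

/-- The labels `1, …, n` of the strands of a web. -/
abbrev WebLabel (n : ℕ) : Type := {a : ℕ // 1 ≤ a ∧ a ≤ n}

/-- The sum of two strand labels. -/
def WebLabel.add {n : ℕ} (i j : WebLabel n) (h : i.1 + j.1 ≤ n) : WebLabel n :=
  ⟨i.1 + j.1, i.2.1.trans (Nat.le_add_right _ _), h⟩

theorem WebLabel.add_add {n : ℕ} (i j l : WebLabel n) (h : i.1 + j.1 + l.1 ≤ n) :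
    i.add (j.add l (by omega)) ((Nat.add_assoc _ _ _).symm.trans_le h) =
      (i.add j (by omega)).add l h :=
  Subtype.ext (Nat.add_assoc _ _ _).symm

/-- The largest strand label, `n`. -/
def WebLabel.top {n : ℕ} (hn : 1 ≤ n) : WebLabel n := ⟨n, hn, le_rfl⟩

theorem WebLabel.add_eq_top {n : ℕ} (i j : WebLabel n) (h : i.1 + j.1 = n) :
    i.add j h.le = WebLabel.top (i.2.1.trans i.2.2) := Subtype.ext h

/-- Formal `k`-linear combinations of horizontal composites (`tensor`) and vertical composites
(`comp`, read from bottom to top) of the generating webs: the trivalent vertices `merge` and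
`split` and the univalent vertices `dot` (an `n`-strand ending at the top) and `codot`
(an `n`-strand starting at the bottom). -/
inductive PreWeb (k : Type u) (n : ℕ) : List (WebLabel n) → List (WebLabel n) → Type u
  | id (a : List (WebLabel n)) : PreWeb k n a a
  | comp {a b c : List (WebLabel n)} (f : PreWeb k n a b) (g : PreWeb k n b c) : PreWeb k n a c
  | tensor {a b c d : List (WebLabel n)} (f : PreWeb k n a b) (g : PreWeb k n c d) :
      PreWeb k n (a ++ c) (b ++ d)
  | zero {a b : List (WebLabel n)} : PreWeb k n a b
  | add {a b : List (WebLabel n)} (f g : PreWeb k n a b) : PreWeb k n a b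
  | smul {a b : List (WebLabel n)} (r : k) (f : PreWeb k n a b) : PreWeb k n a b
  | merge (i j : WebLabel n) (h : i.1 + j.1 ≤ n) : PreWeb k n [i, j] [i.add j h]
  | split (i j : WebLabel n) (h : i.1 + j.1 ≤ n) : PreWeb k n [i.add j h] [i, j]
  | dot (hn : 1 ≤ n) : PreWeb k n [WebLabel.top hn] []
  | codot (hn : 1 ≤ n) : PreWeb k n [] [WebLabel.top hn]

namespace PreWeb

variable {k : Type u} {n : ℕ}

/-- Transport along equalities of source and target. -/
def cast {a b a' b' : List (WebLabel n)} (h : a = a') (h' : b = b') (f : PreWeb k n a b) :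
    PreWeb k n a' b' :=
  h ▸ h' ▸ f

/-- The sum `f 0 + ⋯ + f (N - 1)`. -/
def sum {a b : List (WebLabel n)} (f : ℕ → PreWeb k n a b) : ℕ → PreWeb k n a b
  | 0 => zero
  | N + 1 => add (sum f N) (f N)

/-- The object given by a single strand labelled `a`, where a strand labelled `0` is no strand.
(The value for `a > n` is irrelevant: webs with such a strand are zero.) -/
def strand (n a : ℕ) : List (WebLabel n) := if h : 1 ≤ a ∧ a ≤ n then [⟨a, h⟩] else []

theorem strand_zero (n : ℕ) : strand n 0 = [] := dif_neg (by simp)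

theorem strand_of_pos {a : ℕ} (h : a ≠ 0) (h' : a ≤ n) :
    strand n a = [⟨a, Nat.one_le_iff_ne_zero.2 h, h'⟩] :=
  dif_pos ⟨Nat.one_le_iff_ne_zero.2 h, h'⟩

theorem strand_add_of_eq_zero_left {a : ℕ} (b : ℕ) (h : a = 0) :
    strand n (a + b) = strand n a ++ strand n b := by
  rw [h, strand_zero, zero_add, List.nil_append]

theorem strand_add_of_eq_zero_right (a : ℕ) {b : ℕ} (h : b = 0) :
    strand n (a + b) = strand n a ++ strand n b := by
  rw [h, strand_zero, add_zero, List.append_nil]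

theorem strand_append {a b : ℕ} (ha : a ≠ 0) (hb : b ≠ 0) (h : a + b ≤ n) :
    [(⟨a, Nat.one_le_iff_ne_zero.2 ha, (Nat.le_add_right a b).trans h⟩ : WebLabel n),
      ⟨b, Nat.one_le_iff_ne_zero.2 hb, (Nat.le_add_left b a).trans h⟩] =
      strand n a ++ strand n b := by
  rw [strand_of_pos ha ((Nat.le_add_right a b).trans h),
    strand_of_pos hb ((Nat.le_add_left b a).trans h), List.singleton_append]

theorem strand_add {a b : ℕ} (ha : a ≠ 0) (hb : b ≠ 0) (h : a + b ≤ n) :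
    [WebLabel.add (⟨a, Nat.one_le_iff_ne_zero.2 ha, (Nat.le_add_right a b).trans h⟩ : WebLabel n)
      ⟨b, Nat.one_le_iff_ne_zero.2 hb, (Nat.le_add_left b a).trans h⟩ h] = strand n (a + b) :=
  (strand_of_pos (fun h0 => ha (Nat.eq_zero_of_add_eq_zero_right h0)) h).symm

/-- The merge vertex with arbitrary natural numbers as labels: it is zero if the label `a + b`
exceeds `n`, and an identity if `a` or `b` is zero. -/
def mergeNat (k : Type u) (n a b : ℕ) : PreWeb k n (strand n a ++ strand n b) (strand n (a + b)) :=
  if h : a + b ≤ n then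
    if ha : a = 0 then cast (strand_add_of_eq_zero_left b ha) rfl (id _)
    else if hb : b = 0 then cast (strand_add_of_eq_zero_right a hb) rfl (id _)
    else cast (strand_append ha hb h) (strand_add ha hb h) (merge _ _ h)
  else zero

/-- The split vertex with arbitrary natural numbers as labels: it is zero if the label `a + b`
exceeds `n`, and an identity if `a` or `b` is zero. -/
def splitNat (k : Type u) (n a b : ℕ) : PreWeb k n (strand n (a + b)) (strand n a ++ strand n b) :=
  if h : a + b ≤ n then
    if ha : a = 0 then cast rfl (strand_add_of_eq_zero_left b ha) (id _)
    else if hb : b = 0 then cast rfl (strand_add_of_eq_zero_right a hb) (id _)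
    else cast (strand_add ha hb h) (strand_append ha hb h) (split _ _ h)
  else zero

/-- Two uprights, labelled `m` and `l` at the bottom and `m'` and `l'` at the top, joined by a rung
labelled `r` that ascends from the left upright to the right one. There is such a web only if
`m = m' + r` and `l' = r + l`; otherwise the value is zero. -/
def rungRight (k : Type u) (n m l m' l' r : ℕ) :
    PreWeb k n (strand n m ++ strand n l) (strand n m' ++ strand n l') :=
  if h : m = m' + r ∧ l' = r + l then
    cast (by rw [h.1]) (by rw [h.2])
      (comp (cast rfl (List.append_assoc _ _ _) (tensor (splitNat k n m' r) (id (strand n l))))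
        (tensor (id (strand n m')) (mergeNat k n r l)))
  else zero

/-- Two uprights, labelled `m` and `l` at the bottom and `m'` and `l'` at the top, joined by a rung
labelled `r` that ascends from the right upright to the left one. There is such a web only if
`l = r + l'` and `m' = m + r`; otherwise the value is zero. -/
def rungLeft (k : Type u) (n m l m' l' r : ℕ) :
    PreWeb k n (strand n m ++ strand n l) (strand n m' ++ strand n l') :=
  if h : l = r + l' ∧ m' = m + r then
    cast (by rw [h.1]) (by rw [h.2])
      (comp (tensor (id (strand n m)) (splitNat k n r l'))
        (cast (List.append_assoc _ _ _) rfl (tensor (mergeNat k n m r) (id (strand n l')))))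
  else zero

/-- A merge of `i` and `n - i`, followed by the univalent vertex. -/
def cap (k : Type u) {n : ℕ} (i j : WebLabel n) (h : i.1 + j.1 = n) : PreWeb k n [i, j] [] :=
  comp (merge i j h.le)
    (cast (by rw [WebLabel.add_eq_top i j h]) rfl (dot (i.2.1.trans i.2.2)))

/-- The univalent vertex, followed by a split into `i` and `n - i`. -/
def cup (k : Type u) {n : ℕ} (i j : WebLabel n) (h : i.1 + j.1 = n) : PreWeb k n [] [i, j] :=
  comp (codot (i.2.1.trans i.2.2))
    (cast (by rw [WebLabel.add_eq_top i j h]) rfl (split i j h.le))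

/-- The generalized binomial coefficient `x (x - 1) ⋯ (x - t + 1) / t!` of an integer `x`, as an
element of `k`. -/
def binom (k : Type u) [Field k] (x : ℤ) (t : ℕ) : k := ((Ring.choose x t : ℤ) : k)

end PreWeb

open PreWeb in
/-- The defining relations of `Web(SL_n^-)`. -/
inductive WebRel (k : Type u) [Field k] (n : ℕ) :
    ∀ {a b : List (WebLabel n)}, PreWeb k n a b → PreWeb k n a b → Prop
  /-- Associativity. -/
  | merge_assoc (i j l : WebLabel n) (h : i.1 + j.1 + l.1 ≤ n) :
      WebRel k n
        (comp (tensor (merge i j (by omega)) (id [l]) : PreWeb k n [i, j, l] [i.add j (by omega), l])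
          (merge (i.add j (by omega)) l h))
        (comp (tensor (id [i]) (merge j l (by omega)) : PreWeb k n [i, j, l] [i, j.add l (by omega)])
          (cast rfl (by rw [WebLabel.add_add i j l h])
            (merge i (j.add l (by omega)) ((Nat.add_assoc _ _ _).symm.trans_le h))))
  /-- Coassociativity. -/
  | split_assoc (i j l : WebLabel n) (h : i.1 + j.1 + l.1 ≤ n) :
      WebRel k n
        (comp (split (i.add j (by omega)) l h)
          (tensor (split i j (by omega)) (id [l]) : PreWeb k n [i.add j (by omega), l] [i, j, l]))
        (comp (cast (by rw [WebLabel.add_add i j l h]) rfl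
            (split i (j.add l (by omega)) ((Nat.add_assoc _ _ _).symm.trans_le h)))
          (tensor (id [i]) (split j l (by omega)) : PreWeb k n [i, j.add l (by omega)] [i, j, l]))
  /-- Bigon bursting. -/
  | bigon (i j : WebLabel n) (h : i.1 + j.1 ≤ n) :
      WebRel k n (comp (split i j h) (merge i j h))
        (smul ((i.1 + j.1).choose i.1 : k) (id [i.add j h]))
  /-- The first square switch relation. -/
  | square_switch_right (m l m' l' i j : ℕ) (hm : m ≤ n) (hl : l ≤ n) (hm' : m' ≤ n) (hl' : l' ≤ n)
      (h₁ : m + i = m' + j) (h₂ : l + j = l' + i) :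
      WebRel k n
        (comp (rungRight k n m l (m - j) (l + j) j) (rungLeft k n (m - j) (l + j) m' l' i))
        (sum (fun t => smul (binom k ((m : ℤ) - l + i - j) t)
          (comp (rungLeft k n m l (m + (i - t)) (l - (i - t)) (i - t))
            (rungRight k n (m + (i - t)) (l - (i - t)) m' l' (j - t)))) (min i j + 1))
  /-- The second square switch relation. -/
  | square_switch_left (m l m' l' i j : ℕ) (hm : m ≤ n) (hl : l ≤ n) (hm' : m' ≤ n) (hl' : l' ≤ n)
      (h₁ : m + j = m' + i) (h₂ : l + i = l' + j) :
      WebRel k n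
        (comp (rungLeft k n m l (m + j) (l - j) j) (rungRight k n (m + j) (l - j) m' l' i))
        (sum (fun t => smul (binom k ((l : ℤ) - m + i - j) t)
          (comp (rungRight k n m l (m - (i - t)) (l + (i - t)) (i - t))
            (rungLeft k n (m - (i - t)) (l + (i - t)) m' l' (j - t)))) (min i j + 1))
  /-- A dotted strand and a codotted strand compose to the identity of `n` ... -/
  | dot_codot (hn : 1 ≤ n) : WebRel k n (comp (dot hn) (codot hn)) (id [WebLabel.top hn])
  /-- ... and to the empty web. -/
  | codot_dot (hn : 1 ≤ n) : WebRel k n (comp (codot hn) (dot hn)) (id [])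
  /-- The first `SL_n^-` relation. -/
  | snake_left (i j : WebLabel n) (h : i.1 + j.1 = n) (h' : j.1 + i.1 = n) :
      WebRel k n (id [i])
        (comp (tensor (id [i]) (cup k j i h') : PreWeb k n [i] [i, j, i])
          (tensor (cap k i j h) (id [i]) : PreWeb k n [i, j, i] [i]))
  /-- The second `SL_n^-` relation. -/
  | snake_right (i j : WebLabel n) (h : i.1 + j.1 = n) (h' : j.1 + i.1 = n) :
      WebRel k n (id [i])
        (comp (tensor (cup k i j h) (id [i]) : PreWeb k n [i] [i, j, i])
          (tensor (id [i]) (cap k j i h') : PreWeb k n [i, j, i] [i]))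

open PreWeb in
/-- The congruence generated by the defining relations and by the axioms of a `k`-linear strict
monoidal category. -/
inductive WebCong (k : Type u) [Field k] (n : ℕ) :
    ∀ {a b : List (WebLabel n)}, PreWeb k n a b → PreWeb k n a b → Prop
  | rel {a b} {f g : PreWeb k n a b} (h : WebRel k n f g) : WebCong k n f g
  | refl {a b} (f : PreWeb k n a b) : WebCong k n f f
  | symm {a b} {f g : PreWeb k n a b} (h : WebCong k n f g) : WebCong k n g f
  | trans {a b} {f g h : PreWeb k n a b} (h₁ : WebCong k n f g) (h₂ : WebCong k n g h) :
      WebCong k n f h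
  | comp_congr {a b c} {f f' : PreWeb k n a b} {g g' : PreWeb k n b c} (h₁ : WebCong k n f f')
      (h₂ : WebCong k n g g') : WebCong k n (comp f g) (comp f' g')
  | tensor_congr {a b c d} {f f' : PreWeb k n a b} {g g' : PreWeb k n c d}
      (h₁ : WebCong k n f f') (h₂ : WebCong k n g g') : WebCong k n (tensor f g) (tensor f' g')
  | add_congr {a b} {f f' g g' : PreWeb k n a b} (h₁ : WebCong k n f f')
      (h₂ : WebCong k n g g') : WebCong k n (add f g) (add f' g')
  | smul_congr {a b} (r : k) {f f' : PreWeb k n a b} (h : WebCong k n f f') :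
      WebCong k n (smul r f) (smul r f')
  | id_comp {a b} (f : PreWeb k n a b) : WebCong k n (comp (id a) f) f
  | comp_id {a b} (f : PreWeb k n a b) : WebCong k n (comp f (id b)) f
  | comp_assoc {a b c d} (f : PreWeb k n a b) (g : PreWeb k n b c) (h : PreWeb k n c d) :
      WebCong k n (comp (comp f g) h) (comp f (comp g h))
  | add_assoc {a b} (f g h : PreWeb k n a b) :
      WebCong k n (add (add f g) h) (add f (add g h))
  | add_comm {a b} (f g : PreWeb k n a b) : WebCong k n (add f g) (add g f)
  | zero_add {a b} (f : PreWeb k n a b) : WebCong k n (add zero f) f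
  | zero_smul {a b} (f : PreWeb k n a b) : WebCong k n (smul 0 f) zero
  | one_smul {a b} (f : PreWeb k n a b) : WebCong k n (smul 1 f) f
  | mul_smul {a b} (r s : k) (f : PreWeb k n a b) :
      WebCong k n (smul (r * s) f) (smul r (smul s f))
  | add_smul {a b} (r s : k) (f : PreWeb k n a b) :
      WebCong k n (smul (r + s) f) (add (smul r f) (smul s f))
  | smul_add {a b} (r : k) (f g : PreWeb k n a b) :
      WebCong k n (smul r (add f g)) (add (smul r f) (smul r g))
  | add_comp {a b c} (f f' : PreWeb k n a b) (g : PreWeb k n b c) :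
      WebCong k n (comp (add f f') g) (add (comp f g) (comp f' g))
  | comp_add {a b c} (f : PreWeb k n a b) (g g' : PreWeb k n b c) :
      WebCong k n (comp f (add g g')) (add (comp f g) (comp f g'))
  | smul_comp {a b c} (r : k) (f : PreWeb k n a b) (g : PreWeb k n b c) :
      WebCong k n (comp (smul r f) g) (smul r (comp f g))
  | comp_smul {a b c} (r : k) (f : PreWeb k n a b) (g : PreWeb k n b c) :
      WebCong k n (comp f (smul r g)) (smul r (comp f g))
  | add_tensor {a b c d} (f f' : PreWeb k n a b) (g : PreWeb k n c d) :
      WebCong k n (tensor (add f f') g) (add (tensor f g) (tensor f' g))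
  | tensor_add {a b c d} (f : PreWeb k n a b) (g g' : PreWeb k n c d) :
      WebCong k n (tensor f (add g g')) (add (tensor f g) (tensor f g'))
  | smul_tensor {a b c d} (r : k) (f : PreWeb k n a b) (g : PreWeb k n c d) :
      WebCong k n (tensor (smul r f) g) (smul r (tensor f g))
  | tensor_smul {a b c d} (r : k) (f : PreWeb k n a b) (g : PreWeb k n c d) :
      WebCong k n (tensor f (smul r g)) (smul r (tensor f g))
  | tensor_id (a b : List (WebLabel n)) : WebCong k n (tensor (id a) (id b)) (id (a ++ b))
  | interchange {a b c a' b' c'} (f : PreWeb k n a b) (g : PreWeb k n b c)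
      (f' : PreWeb k n a' b') (g' : PreWeb k n b' c') :
      WebCong k n (tensor (comp f g) (comp f' g')) (comp (tensor f f') (tensor g g'))
  | tensor_assoc {a b c a' b' c'} (f : PreWeb k n a a') (g : PreWeb k n b b')
      (h : PreWeb k n c c') :
      WebCong k n (cast (List.append_assoc a b c) (List.append_assoc a' b' c')
        (tensor (tensor f g) h)) (tensor f (tensor g h))
  | id_nil_tensor {a b} (f : PreWeb k n a b) : WebCong k n (tensor (id []) f) f
  | tensor_id_nil {a b} (f : PreWeb k n a b) :
      WebCong k n (cast (List.append_nil a) (List.append_nil b) (tensor f (id []))) f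

/-- The category `Web(SL_n^-)` over the field `k`: its objects are finite sequences in
`{1, …, n}`. -/
@[ext]
structure Web (k : Type u) (n : ℕ) where
  seq : List (WebLabel n)

namespace Web

variable {k : Type u} {n : ℕ}

/-- The tensor product of two objects: concatenation of sequences. -/
def tensorObj (X Y : Web k n) : Web k n := ⟨X.seq ++ Y.seq⟩

theorem tensorObj_assoc (X Y Z : Web k n) :
    tensorObj (tensorObj X Y) Z = tensorObj X (tensorObj Y Z) :=
  congrArg mk (List.append_assoc _ _ _)

theorem tensorObj_nil (X : Web k n) : tensorObj X ⟨[]⟩ = X :=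
  congrArg mk (List.append_nil _)

theorem nil_tensorObj (X : Web k n) : tensorObj ⟨[]⟩ X = X := rfl

variable [Field k]

/-- Two formal webs are identified if they are congruent. -/
def setoid (a b : List (WebLabel n)) : Setoid (PreWeb k n a b) where
  r := WebCong k n
  iseqv := ⟨WebCong.refl, WebCong.symm, WebCong.trans⟩

/-- Morphisms of `Web(SL_n^-)`. -/
def Hom (X Y : Web k n) : Type u := Quotient (setoid (k := k) X.seq Y.seq)

instance : Category (Web k n) where
  Hom := Hom
  id X := Quotient.mk _ (.id X.seq)
  comp := Quotient.map₂ .comp fun _ _ h _ _ h' => .comp_congr h h'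
  id_comp f := Quotient.inductionOn f fun f => Quotient.sound (.id_comp f)
  comp_id f := Quotient.inductionOn f fun f => Quotient.sound (.comp_id f)
  assoc f g h := Quotient.inductionOn₃ f g h fun f g h => Quotient.sound (.comp_assoc f g h)

/-- The morphism represented by a formal web. -/
def ofPreWeb {a b : List (WebLabel n)} (f : PreWeb k n a b) : (⟨a⟩ : Web k n) ⟶ ⟨b⟩ :=
  Quotient.mk _ f

theorem ofPreWeb_eq {a b : List (WebLabel n)} {f g : PreWeb k n a b} (h : WebCong k n f g) :
    ofPreWeb f = ofPreWeb g := Quotient.sound h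

theorem ofPreWeb_surjective {X Y : Web k n} (f : X ⟶ Y) :
    ∃ f' : PreWeb k n X.seq Y.seq, ofPreWeb f' = f := Quotient.exists_rep f

theorem ofPreWeb_cast {a b a' b' : List (WebLabel n)} (h : a = a') (h' : b = b')
    (f : PreWeb k n a b) :
    ofPreWeb (f.cast h h') =
      eqToHom (congrArg mk h.symm) ≫ ofPreWeb f ≫ eqToHom (congrArg mk h') := by
  subst h h'
  simp [PreWeb.cast]

/-! ### The linear structure -/

instance (X Y : Web k n) : Zero (X ⟶ Y) := ⟨ofPreWeb .zero⟩
instance (X Y : Web k n) : Add (X ⟶ Y) :=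
  ⟨Quotient.map₂ .add fun _ _ h _ _ h' => .add_congr h h'⟩
instance (X Y : Web k n) : SMul k (X ⟶ Y) :=
  ⟨fun r => Quotient.map (.smul r) fun _ _ h => .smul_congr r h⟩

protected theorem add_assoc {X Y : Web k n} (f g h : X ⟶ Y) : f + g + h = f + (g + h) :=
  Quotient.inductionOn₃ f g h fun f g h => Quotient.sound (.add_assoc f g h)
protected theorem add_comm {X Y : Web k n} (f g : X ⟶ Y) : f + g = g + f :=
  Quotient.inductionOn₂ f g fun f g => Quotient.sound (.add_comm f g)
protected theorem zero_add {X Y : Web k n} (f : X ⟶ Y) : 0 + f = f :=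
  Quotient.inductionOn f fun f => Quotient.sound (.zero_add f)
protected theorem zero_smul {X Y : Web k n} (f : X ⟶ Y) : (0 : k) • f = 0 :=
  Quotient.inductionOn f fun f => Quotient.sound (.zero_smul f)
protected theorem one_smul {X Y : Web k n} (f : X ⟶ Y) : (1 : k) • f = f :=
  Quotient.inductionOn f fun f => Quotient.sound (.one_smul f)
protected theorem mul_smul {X Y : Web k n} (r s : k) (f : X ⟶ Y) : (r * s) • f = r • s • f :=
  Quotient.inductionOn f fun f => Quotient.sound (.mul_smul r s f)
protected theorem add_smul {X Y : Web k n} (r s : k) (f : X ⟶ Y) : (r + s) • f = r • f + s • f :=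
  Quotient.inductionOn f fun f => Quotient.sound (.add_smul r s f)
protected theorem smul_add {X Y : Web k n} (r : k) (f g : X ⟶ Y) : r • (f + g) = r • f + r • g :=
  Quotient.inductionOn₂ f g fun f g => Quotient.sound (.smul_add r f g)

instance (X Y : Web k n) : Neg (X ⟶ Y) := ⟨fun f => (-1 : k) • f⟩

instance (X Y : Web k n) : AddCommGroup (X ⟶ Y) where
  add_assoc := Web.add_assoc
  zero_add := Web.zero_add
  add_zero f := by rw [Web.add_comm, Web.zero_add]
  add_comm := Web.add_comm
  neg_add_cancel f := by
    change (-1 : k) • f + f = 0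
    conv_lhs => rw [← Web.one_smul f, ← Web.mul_smul, ← Web.add_smul]
    rw [mul_one, neg_add_cancel, Web.zero_smul]
  nsmul := nsmulRec
  zsmul := zsmulRec

instance (X Y : Web k n) : Module k (X ⟶ Y) :=
  Module.ofMinimalAxioms Web.smul_add Web.add_smul Web.mul_smul Web.one_smul

protected theorem add_comp {X Y Z : Web k n} (f f' : X ⟶ Y) (g : Y ⟶ Z) :
    (f + f') ≫ g = f ≫ g + f' ≫ g :=
  Quotient.inductionOn₃ f f' g fun f f' g => Quotient.sound (.add_comp f f' g)
protected theorem comp_add {X Y Z : Web k n} (f : X ⟶ Y) (g g' : Y ⟶ Z) :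
    f ≫ (g + g') = f ≫ g + f ≫ g' :=
  Quotient.inductionOn₃ f g g' fun f g g' => Quotient.sound (.comp_add f g g')
protected theorem smul_comp {X Y Z : Web k n} (r : k) (f : X ⟶ Y) (g : Y ⟶ Z) :
    (r • f) ≫ g = r • (f ≫ g) :=
  Quotient.inductionOn₂ f g fun f g => Quotient.sound (.smul_comp r f g)
protected theorem comp_smul {X Y Z : Web k n} (f : X ⟶ Y) (r : k) (g : Y ⟶ Z) :
    f ≫ (r • g) = r • (f ≫ g) :=
  Quotient.inductionOn₂ f g fun f g => Quotient.sound (.comp_smul r f g)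

instance : Preadditive (Web k n) where
  add_comp _ _ _ := Web.add_comp
  comp_add _ _ _ := Web.comp_add

instance : Linear k (Web k n) where
  smul_comp _ _ _ := Web.smul_comp
  comp_smul _ _ _ := Web.comp_smul

/-! ### The monoidal structure -/

/-- The tensor product of two morphisms: horizontal composition. -/
def tensorHom {X Y X' Y' : Web k n} (f : X ⟶ Y) (g : X' ⟶ Y') :
    tensorObj X X' ⟶ tensorObj Y Y' :=
  Quotient.map₂ .tensor (fun _ _ h _ _ h' => .tensor_congr h h') f g

theorem tensorHom_id (X Y : Web k n) : tensorHom (𝟙 X) (𝟙 Y) = 𝟙 (tensorObj X Y) :=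
  Quotient.sound (.tensor_id X.seq Y.seq)

theorem tensorHom_comp {X Y Z X' Y' Z' : Web k n} (f : X ⟶ Y) (g : Y ⟶ Z) (f' : X' ⟶ Y')
    (g' : Y' ⟶ Z') : tensorHom (f ≫ g) (f' ≫ g') = tensorHom f f' ≫ tensorHom g g' :=
  Quotient.inductionOn₂ f g fun f g => Quotient.inductionOn₂ f' g' fun f' g' =>
    Quotient.sound (.interchange f g f' g')

theorem tensorHom_eqToHom {X Y X' Y' : Web k n} (h : X = Y) (h' : X' = Y') :
    tensorHom (eqToHom h) (eqToHom h') = eqToHom (by rw [h, h']) := by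
  subst h h'
  exact tensorHom_id _ _

theorem comp_eqToHom_of_cast {a b a' b' : List (WebLabel n)} (h : a = a') (h' : b = b')
    {f : PreWeb k n a b} {g : PreWeb k n a' b'} (hfg : WebCong k n (f.cast h h') g) :
    ofPreWeb f ≫ eqToHom (congrArg mk h') = eqToHom (congrArg mk h) ≫ ofPreWeb g := by
  subst h h'
  rw [← ofPreWeb_eq hfg]
  exact (Category.comp_id _).trans (Category.id_comp _).symm

theorem tensorHom_assoc {X Y Z X' Y' Z' : Web k n} (f : X ⟶ X') (g : Y ⟶ Y') (h : Z ⟶ Z') :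
    tensorHom (tensorHom f g) h ≫ eqToHom (tensorObj_assoc X' Y' Z') =
      eqToHom (tensorObj_assoc X Y Z) ≫ tensorHom f (tensorHom g h) :=
  Quotient.inductionOn₃ f g h fun f g h => comp_eqToHom_of_cast
    (List.append_assoc _ _ _) (List.append_assoc _ _ _) (.tensor_assoc f g h)

theorem tensorHom_unit_right {X Y : Web k n} (f : X ⟶ Y) :
    tensorHom f (𝟙 (⟨[]⟩ : Web k n)) ≫ eqToHom (tensorObj_nil Y) =
      eqToHom (tensorObj_nil X) ≫ f :=
  Quotient.inductionOn f fun f => comp_eqToHom_of_cast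
    (List.append_nil _) (List.append_nil _) (.tensor_id_nil f)

theorem tensorHom_unit_left {X Y : Web k n} (f : X ⟶ Y) :
    tensorHom (𝟙 (⟨[]⟩ : Web k n)) f ≫ eqToHom (nil_tensorObj Y) =
      eqToHom (nil_tensorObj X) ≫ f := by
  refine (Category.comp_id _).trans (Eq.trans ?_ (Category.id_comp _).symm)
  exact Quotient.inductionOn f fun f => Quotient.sound (.id_nil_tensor f)

theorem pentagon_aux (W X Y Z : Web k n) :
    tensorHom (eqToHom (tensorObj_assoc W X Y)) (𝟙 Z) ≫
        eqToHom (tensorObj_assoc W (tensorObj X Y) Z) ≫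
          tensorHom (𝟙 W) (eqToHom (tensorObj_assoc X Y Z)) =
      eqToHom (tensorObj_assoc (tensorObj W X) Y Z) ≫
        eqToHom (tensorObj_assoc W X (tensorObj Y Z)) := by
  rw [← eqToHom_refl Z rfl, ← eqToHom_refl W rfl]
  simp only [tensorHom_eqToHom, eqToHom_trans]

theorem triangle_aux (X Y : Web k n) :
    eqToHom (tensorObj_assoc X ⟨[]⟩ Y) ≫ tensorHom (𝟙 X) (eqToHom (nil_tensorObj Y)) =
      tensorHom (eqToHom (tensorObj_nil X)) (𝟙 Y) := by
  rw [← eqToHom_refl Y rfl, ← eqToHom_refl X rfl]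
  simp only [tensorHom_eqToHom, eqToHom_trans]

instance : MonoidalCategoryStruct (Web k n) where
  tensorObj := tensorObj
  tensorHom := tensorHom
  whiskerLeft X _ _ f := tensorHom (𝟙 X) f
  whiskerRight f Y := tensorHom f (𝟙 Y)
  tensorUnit := ⟨[]⟩
  associator X Y Z := eqToIso (tensorObj_assoc X Y Z)
  leftUnitor X := eqToIso (nil_tensorObj X)
  rightUnitor X := eqToIso (tensorObj_nil X)

instance : MonoidalCategory (Web k n) :=
  MonoidalCategory.ofTensorHom
    (id_tensorHom_id := tensorHom_id)
    (id_tensorHom := fun _ _ _ _ => rfl)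
    (tensorHom_id := fun _ _ => rfl)
    (tensorHom_comp_tensorHom := fun f g h i => (tensorHom_comp f h g i).symm)
    (associator_naturality := tensorHom_assoc)
    (leftUnitor_naturality := tensorHom_unit_left)
    (rightUnitor_naturality := tensorHom_unit_right)
    (pentagon := pentagon_aux)
    (triangle := triangle_aux)

end Web

/-! ## The assignment on objects -/

/-- Reduction modulo `n` of a sequence in `{1, …, n}`: the entries equal to `n`, for which the
weight lattice graph has no edges, are replaced by the empty sequence. -/
def reduceSeq {n : ℕ} (a : List (WebLabel n)) : List (EdgeLabel n) :=
  a.filterMap fun i => if h : i.1 < n then some ⟨i.1, i.2.1, h⟩ else none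

/-- The object of `G(Γ)`, for `Γ` the `sl_n` weight lattice, assigned to an object of
`Web(SL_n^-)`. -/
def Web.reduce {k : Type u} {n : ℕ} (X : Web k n) : GPA k (weightGraph n) := ⟨reduceSeq X.seq⟩

theorem Web.reduce_tensor {k : Type u} [Field k] {n : ℕ} (X Y : Web k n) :
    Web.reduce (MonoidalCategoryStruct.tensorObj X Y) =
      MonoidalCategoryStruct.tensorObj X.reduce Y.reduce :=
  congrArg GPA.mk List.filterMap_append

theorem Web.reduce_unit {k : Type u} [Field k] {n : ℕ} :
    Web.reduce (MonoidalCategoryStruct.tensorUnit (Web k n)) =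
      MonoidalCategoryStruct.tensorUnit (GPA k (weightGraph n)) := rfl

/-!
Up to its starting point, a path in the weight lattice is the list of subsets `A` of `Fin n` whose
weights are its steps. Allowing also the empty and the full subset, which give no step, treats
strands labelled `0` and `n` uniformly with the others. Two lists of subsets of the same total
cardinality give paths with the same endpoint if and only if every `i` lies in equally many of their
members. In these terms a merge becomes the 0-1 matrix of the relation `C = A ∪ B`, `A` and `B`
disjoint, and every relation between webs becomes a counting identity for subsets.

A ladder with two rungs from `(A, B)` to `(A', B')` exists only if `A ∩ B = A' ∩ B'` and
`A ∪ B = A' ∪ B'`. The composites `E F` and `F E` then count the sets of given cardinality in the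
intervals `[A ∩ B, A ∩ A']` and `[A ∪ A', A ∪ B]`, so the square switch relations are instances of
the Chu-Vandermonde identity. Reflecting webs in a horizontal line transposes these matrices, which
gives half of the relations from the other half.
-/

/-! ## Weights of lists of subsets -/

section Weights

variable {α : Type*} [DecidableEq α] {n : ℕ}

/-- The number of members of a list of sets that contain a given element. -/
def coverCount (s : List (Finset α)) (i : α) : ℕ := s.countP (i ∈ ·)

theorem coverCount_cons (A : Finset α) (s : List (Finset α)) (i : α) :
    coverCount (A :: s) i = coverCount s i + if i ∈ A then 1 else 0 := by
  simp [coverCount, List.countP_cons]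

theorem coverCount_nil (i : α) : coverCount [] i = 0 := rfl

theorem sum_coverCount [Fintype α] (s : List (Finset α)) :
    ∑ i, coverCount s i = (s.map Finset.card).sum := by
  induction s with
  | nil => simp [coverCount_nil]
  | cons A s ih => simp [coverCount_cons, Finset.sum_add_distrib, ih, add_comm]

/-- The total displacement of the walk that takes the weights of the members of a list of subsets
as its steps. -/
def totalWeight (s : List (Finset (Fin n))) : WeightLattice n := (s.map (subsetWeight n)).sum

theorem totalWeight_nil : totalWeight ([] : List (Finset (Fin n))) = 0 := rfl

theorem totalWeight_cons (A : Finset (Fin n)) (s : List (Finset (Fin n))) :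
    totalWeight (A :: s) = subsetWeight n A + totalWeight s := rfl

theorem totalWeight_eq_mk (s : List (Finset (Fin n))) :
    totalWeight s = QuotientAddGroup.mk' _ fun i => (coverCount s i : ℤ) := by
  induction s with
  | nil => rfl
  | cons A s ih =>
    rw [totalWeight_cons, ih, subsetWeight, ← map_add]
    congr 1
    ext i
    simp [coverCount_cons, Finset.sum_apply, Pi.single_apply, add_comm]

theorem totalWeight_eq_totalWeight_iff {s t : List (Finset (Fin n))} :
    totalWeight s = totalWeight t ↔
      ∃ z : ℤ, ∀ i, (coverCount t i : ℤ) = coverCount s i + z := by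
  rw [totalWeight_eq_mk, totalWeight_eq_mk, QuotientAddGroup.mk'_apply,
    QuotientAddGroup.mk'_apply, QuotientAddGroup.eq, AddSubgroup.mem_zmultiples_iff]
  refine exists_congr fun z => funext_iff.trans (forall_congr' fun i => ?_)
  simp only [Pi.smul_apply, Pi.add_apply, Pi.neg_apply, smul_eq_mul, mul_one]
  omega

theorem totalWeight_eq_iff_coverCount_eq {s t : List (Finset (Fin n))}
    (hc : (s.map Finset.card).sum = (t.map Finset.card).sum) :
    totalWeight s = totalWeight t ↔ ∀ i, coverCount s i = coverCount t i := by
  refine totalWeight_eq_totalWeight_iff.trans ⟨fun ⟨z, hz⟩ i => ?_, fun h => ⟨0, by simp [h]⟩⟩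
  have hsum : ∑ i, (coverCount t i : ℤ) = ∑ i, (coverCount s i : ℤ) := by
    exact_mod_cast (sum_coverCount t).trans (hc.symm.trans (sum_coverCount s).symm)
  have hn : n ≠ 0 := i.pos.ne'
  have hz0 : z = 0 := by simpa [hz, Finset.sum_add_distrib, hn] using hsum
  have hi := hz i
  omega

theorem subsetWeight_eq_zero_iff {A : Finset (Fin n)} :
    subsetWeight n A = 0 ↔ ¬ (1 ≤ A.card ∧ A.card < n) := by
  have hzero : subsetWeight n A = 0 ↔ ∃ z : ℤ, ∀ i, 0 = (if i ∈ A then 1 else 0) + z := by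
    have h := totalWeight_eq_totalWeight_iff (s := [A]) (t := [])
    simpa [totalWeight_cons, totalWeight_nil, coverCount_cons, coverCount_nil] using h
  rw [hzero]
  constructor
  · rintro ⟨z, hz⟩ ⟨hpos, hlt⟩
    obtain ⟨i, hi⟩ := Finset.card_pos.1 hpos
    obtain ⟨j, hj⟩ : ∃ j, j ∉ A := by
      by_contra! hA
      rw [Finset.eq_univ_iff_forall.2 hA, Finset.card_univ, Fintype.card_fin] at hlt
      exact hlt.false
    have hzi := hz i
    have hzj := hz j
    rw [if_pos hi] at hzi
    rw [if_neg hj] at hzj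
    omega
  · intro h
    rcases A.eq_empty_or_nonempty with rfl | hA
    · exact ⟨0, by simp⟩
    · have hle : A.card ≤ n := by simpa using A.card_le_univ
      have hcard : A.card = n := by
        have := hA.card_pos
        omega
      have hA : A = Finset.univ := (Finset.card_eq_iff_eq_univ A).1 (by simp [hcard])
      exact ⟨-1, by simp [hA]⟩

theorem eq_of_subsetWeight_eq {A B : Finset (Fin n)} (hc : A.card = B.card)
    (h : subsetWeight n A = subsetWeight n B) : A = B := by
  have hcover := (totalWeight_eq_iff_coverCount_eq (s := [A]) (t := [B]) (by simpa using hc)).1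
    (by simpa [totalWeight_cons, totalWeight_nil] using h)
  ext i
  have hi := hcover i
  simp only [coverCount_cons, coverCount_nil] at hi
  split_ifs at hi <;> simp_all

end Weights

/-! ## Paths in the weight lattice as lists of subsets -/

section Walks

variable {n : ℕ}

/-- The edge labels among the entries of a sequence of natural numbers. Keeping the entries that are
not edge labels lets strands labelled `0` or `n` be treated like all others. -/
def edgeLabels (n : ℕ) (c : List ℕ) : List (EdgeLabel n) :=
  c.filterMap fun a => if h : 1 ≤ a ∧ a < n then some ⟨a, h⟩ else none

theorem edgeLabels_append (c d : List ℕ) :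
    edgeLabels n (c ++ d) = edgeLabels n c ++ edgeLabels n d := List.filterMap_append

theorem edgeLabels_cons_of_pos {a : ℕ} (h : 1 ≤ a ∧ a < n) (c : List ℕ) :
    edgeLabels n (a :: c) = ⟨a, h⟩ :: edgeLabels n c := by
  simp [edgeLabels, h]

theorem edgeLabels_cons_of_neg {a : ℕ} (h : ¬ (1 ≤ a ∧ a < n)) (c : List ℕ) :
    edgeLabels n (a :: c) = edgeLabels n c := by
  simp [edgeLabels, h]

theorem reduceSeq_append (a b : List (WebLabel n)) :
    reduceSeq (a ++ b) = reduceSeq a ++ reduceSeq b := List.filterMap_append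

theorem reduceSeq_eq_edgeLabels (a : List (WebLabel n)) :
    reduceSeq a = edgeLabels n (a.map Subtype.val) := by
  simp only [reduceSeq, edgeLabels, List.filterMap_map]
  congr 1
  ext1 i
  simp [i.2.1]

theorem reduceSeq_strand (a : ℕ) : reduceSeq (PreWeb.strand n a) = edgeLabels n [a] := by
  by_cases h : 1 ≤ a ∧ a ≤ n
  · rw [PreWeb.strand, dif_pos h, reduceSeq_eq_edgeLabels]
    rfl
  · rw [PreWeb.strand, dif_neg h, edgeLabels_cons_of_neg (by omega)]
    rfl

/-- The vertices visited after `x` by the walk whose steps are the weights of the members of a list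
of subsets; the empty and the full set give no step. -/
def walkOf (x : WeightLattice n) : List (Finset (Fin n)) → List (WeightLattice n)
  | [] => []
  | A :: s => if 1 ≤ A.card ∧ A.card < n then
      (x + subsetWeight n A) :: walkOf (x + subsetWeight n A) s else walkOf x s

theorem walkOf_cons_of_pos {A : Finset (Fin n)} (h : 1 ≤ A.card ∧ A.card < n)
    (x : WeightLattice n) (s : List (Finset (Fin n))) :
    walkOf x (A :: s) = (x + subsetWeight n A) :: walkOf (x + subsetWeight n A) s := if_pos h

theorem walkOf_cons_of_neg {A : Finset (Fin n)} (h : ¬ (1 ≤ A.card ∧ A.card < n))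
    (x : WeightLattice n) (s : List (Finset (Fin n))) : walkOf x (A :: s) = walkOf x s := if_neg h

theorem isWalk_walkOf (s : List (Finset (Fin n))) (x : WeightLattice n) :
    (weightGraph n).IsWalk x (edgeLabels n (s.map Finset.card)) (walkOf x s) := by
  induction s generalizing x with
  | nil => trivial
  | cons A s ih =>
    by_cases h : 1 ≤ A.card ∧ A.card < n
    · rw [List.map_cons, edgeLabels_cons_of_pos h, walkOf_cons_of_pos h]
      exact ⟨⟨A, rfl, rfl⟩, ih _⟩
    · rw [List.map_cons, edgeLabels_cons_of_neg h, walkOf_cons_of_neg h]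
      exact ih x

theorem exists_eq_walkOf {c : List ℕ} (hc : ∀ a ∈ c, a ≤ n) {x : WeightLattice n}
    {vs : List (WeightLattice n)} (h : (weightGraph n).IsWalk x (edgeLabels n c) vs) :
    ∃ s : List (Finset (Fin n)), s.map Finset.card = c ∧ vs = walkOf x s := by
  induction c generalizing x vs with
  | nil =>
    rcases vs with _ | ⟨y, ys⟩
    · exact ⟨[], rfl, rfl⟩
    · exact h.elim
  | cons a c ih =>
    obtain ⟨han, htail⟩ := List.forall_mem_cons.1 hc
    by_cases ha : 1 ≤ a ∧ a < n
    · rw [edgeLabels_cons_of_pos ha] at h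
      rcases vs with _ | ⟨y, ys⟩
      · exact h.elim
      obtain ⟨⟨A, rfl, rfl⟩, h⟩ := h
      obtain ⟨s, rfl, rfl⟩ := ih htail h
      exact ⟨A :: s, rfl, (walkOf_cons_of_pos ha x s).symm⟩
    · rw [edgeLabels_cons_of_neg ha] at h
      obtain ⟨s, rfl, rfl⟩ := ih htail h
      obtain ⟨A, -, rfl⟩ := Finset.exists_subset_card_eq
        (s := (Finset.univ : Finset (Fin n))) (by simpa using han)
      exact ⟨A :: s, rfl, (walkOf_cons_of_neg ha x s).symm⟩

theorem walkOf_append (s t : List (Finset (Fin n))) (x : WeightLattice n) :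
    walkOf x (s ++ t) = walkOf x s ++ walkOf (x + totalWeight s) t := by
  induction s generalizing x with
  | nil => simp [walkOf, totalWeight_nil]
  | cons A s ih =>
    by_cases h : 1 ≤ A.card ∧ A.card < n
    · rw [List.cons_append, walkOf_cons_of_pos h, walkOf_cons_of_pos h, ih, totalWeight_cons,
        add_assoc, List.cons_append]
    · rw [List.cons_append, walkOf_cons_of_neg h, walkOf_cons_of_neg h, ih, totalWeight_cons,
        subsetWeight_eq_zero_iff.2 h, zero_add]

theorem getLastD_walkOf (s : List (Finset (Fin n))) (x : WeightLattice n) :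
    (walkOf x s).getLastD x = x + totalWeight s := by
  induction s generalizing x with
  | nil => simp [walkOf, totalWeight_nil]
  | cons A s ih =>
    by_cases h : 1 ≤ A.card ∧ A.card < n
    · rw [walkOf_cons_of_pos h, List.getLastD_cons, ih, totalWeight_cons, add_assoc]
    · rw [walkOf_cons_of_neg h, ih, totalWeight_cons, subsetWeight_eq_zero_iff.2 h, zero_add]

theorem walkOf_injOn {s t : List (Finset (Fin n))} {x : WeightLattice n}
    (hc : s.map Finset.card = t.map Finset.card) (h : walkOf x s = walkOf x t) : s = t := by
  induction s generalizing t x with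
  | nil => exact (List.map_eq_nil_iff.1 hc.symm).symm
  | cons A s ih =>
    rcases t with _ | ⟨B, t⟩
    · simp at hc
    obtain ⟨hAB, htail⟩ := List.cons.inj hc
    by_cases hA : 1 ≤ A.card ∧ A.card < n
    · rw [walkOf_cons_of_pos hA, walkOf_cons_of_pos (hAB ▸ hA), List.cons.injEq] at h
      obtain rfl := eq_of_subsetWeight_eq hAB (add_left_cancel h.1)
      rw [ih htail h.2]
    · rw [walkOf_cons_of_neg hA, walkOf_cons_of_neg (hAB ▸ hA)] at h
      have hzero : subsetWeight n A = subsetWeight n B :=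
        (subsetWeight_eq_zero_iff.2 hA).trans (subsetWeight_eq_zero_iff.2 (hAB ▸ hA)).symm
      rw [eq_of_subsetWeight_eq hAB hzero, ih htail h]

/-- The path starting at `x` whose steps are the weights of the members of a list of subsets. -/
def tracePath {σ : List (EdgeLabel n)} (x : WeightLattice n) (s : List (Finset (Fin n)))
    (h : σ = edgeLabels n (s.map Finset.card)) : (weightGraph n).Path σ :=
  ⟨x, walkOf x s, h ▸ isWalk_walkOf s x⟩

theorem exists_rest_eq_walkOf {c : List ℕ} (hc : ∀ a ∈ c, a ≤ n) {σ : List (EdgeLabel n)}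
    (h : σ = edgeLabels n c) (p : (weightGraph n).Path σ) :
    ∃ s : List (Finset (Fin n)), s.map Finset.card = c ∧ p.rest = walkOf p.src s := by
  subst h
  exact exists_eq_walkOf hc p.isWalk

theorem left_rest_eq_walkOf {c c' : List ℕ} {σ σ' : List (EdgeLabel n)}
    {s : List (Finset (Fin n))} (hs : s.map Finset.card = c ++ c') (h : σ = edgeLabels n c)
    {p : (weightGraph n).Path (σ ++ σ')} (hp : p.rest = walkOf p.src s) :
    (p.left σ σ').rest = walkOf p.src (s.take c.length) := by
  have hlen : (walkOf p.src (s.take c.length)).length = σ.length := by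
    refine (isWalk_walkOf (s.take c.length) p.src).length_eq.trans (congrArg List.length ?_)
    rw [h, List.map_take, hs, List.take_left]
  have hwalk := walkOf_append (s.take c.length) (s.drop c.length) p.src
  rw [List.take_append_drop] at hwalk
  change p.rest.take σ.length = _
  rw [hp, hwalk, ← hlen, List.take_left]

theorem right_rest_eq_walkOf {c c' : List ℕ} {σ σ' : List (EdgeLabel n)}
    {s : List (Finset (Fin n))} (hs : s.map Finset.card = c ++ c') (h : σ = edgeLabels n c)
    {p : (weightGraph n).Path (σ ++ σ')} (hp : p.rest = walkOf p.src s) :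
    (p.right σ σ').rest = walkOf (p.right σ σ').src (s.drop c.length) := by
  have hleft := left_rest_eq_walkOf hs h hp
  have hlen : (walkOf p.src (s.take c.length)).length = σ.length := by
    rw [← hleft, (p.left σ σ').isWalk.length_eq]
  have hsrc : (p.right σ σ').src = p.src + totalWeight (s.take c.length) := by
    rw [← getLastD_walkOf, ← hleft]
    rfl
  have hwalk := walkOf_append (s.take c.length) (s.drop c.length) p.src
  rw [List.take_append_drop] at hwalk
  change p.rest.drop σ.length = _
  rw [hp, hsrc, hwalk, ← hlen, List.drop_left]

/-- The lists of subsets with prescribed cardinalities. -/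
def ofCards (n : ℕ) : List ℕ → Finset (List (Finset (Fin n)))
  | [] => {[]}
  | a :: c => (Finset.powersetCard a Finset.univ ×ˢ ofCards n c).map
      ⟨fun z => z.1 :: z.2, fun z z' h => by simpa [Prod.ext_iff] using h⟩

theorem mem_ofCards {c : List ℕ} {s : List (Finset (Fin n))} :
    s ∈ ofCards n c ↔ s.map Finset.card = c := by
  induction c generalizing s with
  | nil => simp [ofCards]
  | cons a c ih =>
    rcases s with _ | ⟨A, s⟩
    · simp [ofCards]
    · simp only [ofCards, Finset.mem_map, Prod.exists, Finset.mem_product,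
        Finset.mem_powersetCard_univ, ih, List.cons.injEq, List.map_cons]
      refine ⟨fun ⟨_, _, h, heq⟩ => ?_, fun h => ⟨A, s, h, rfl⟩⟩
      obtain ⟨rfl, rfl⟩ := List.cons.inj heq
      exact h

theorem sum_ofCards_nil {R : Type*} [AddCommMonoid R] (f : List (Finset (Fin n)) → R) :
    ∑ s ∈ ofCards n [], f s = f [] := Finset.sum_singleton _ _

theorem sum_ofCards_cons {R : Type*} [AddCommMonoid R] (a : ℕ) (c : List ℕ)
    (f : List (Finset (Fin n)) → R) : ∑ s ∈ ofCards n (a :: c), f s =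
      ∑ A ∈ Finset.powersetCard a Finset.univ, ∑ s ∈ ofCards n c, f (A :: s) := by
  rw [ofCards, Finset.sum_map, Finset.sum_product]
  rfl

end Walks

/-! ## Transposition and tensor products up to equality of objects -/

namespace LabeledGraph.Path

variable {V : Type v} {L : Type w} {Γ : LabeledGraph V L} {σ τ : List L}

theorem dropLast_verts_append_tgt (p : Γ.Path σ) : p.verts.dropLast ++ [p.tgt] = p.verts := by
  have hne : p.verts ≠ [] := List.cons_ne_nil _ _
  have hlast : p.verts.getLast hne = p.tgt := List.getLast_eq_getLastD _
  rw [← hlast, List.dropLast_append_getLast]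

theorem BoundsCycle.symm {p : Γ.Path σ} {q : Γ.Path τ} (h : p.BoundsCycle q) :
    q.BoundsCycle p := by
  obtain ⟨⟨hsrc, htgt⟩, hnodup⟩ := h
  refine ⟨⟨hsrc.symm, htgt.symm⟩, (List.Perm.nodup_iff ?_).1 hnodup⟩
  have hp : (p.verts.dropLast : Multiset V) + {p.tgt} = {p.src} + p.verts.tail :=
    congrArg Multiset.ofList p.dropLast_verts_append_tgt
  have hq : (q.verts.dropLast : Multiset V) + {p.tgt} = {p.src} + q.verts.tail := by
    rw [hsrc, htgt]
    exact congrArg Multiset.ofList q.dropLast_verts_append_tgt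
  rw [← Multiset.coe_eq_coe, ← Multiset.coe_add, ← Multiset.coe_add, Multiset.coe_reverse,
    Multiset.coe_reverse]
  refine add_right_cancel (b := {p.tgt} + {p.src}) ?_
  calc (p.verts.dropLast + q.verts.tail + ({p.tgt} + {p.src}) : Multiset V)
      = (p.verts.dropLast + {p.tgt}) + ({p.src} + q.verts.tail) := by abel
    _ = ({p.src} + p.verts.tail) + (q.verts.dropLast + {p.tgt}) := by rw [hp, hq]
    _ = q.verts.dropLast + p.verts.tail + ({p.tgt} + {p.src}) := by abel

theorem boundsCycle_comm {p : Γ.Path σ} {q : Γ.Path τ} : p.BoundsCycle q ↔ q.BoundsCycle p :=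
  ⟨BoundsCycle.symm, BoundsCycle.symm⟩

end LabeledGraph.Path

namespace GPA

variable {k : Type u} [Field k] {V : Type v} {L : Type w} {Γ : LabeledGraph V L}
  {X Y Z W : GPA k Γ}

/-- The transpose of a morphism of the graph planar algebra, regarded as a matrix indexed by
paths. -/
def transpose (f : X ⟶ Y) : Y ⟶ X where
  toFun q p := f.toFun p q
  vanish q p h := f.vanish p q fun h' => h h'.symm

theorem transpose_id : transpose (𝟙 X) = 𝟙 X := by
  classical
  exact hom_ext fun p q => if_congr eq_comm rfl rfl

theorem transpose_comp (f : X ⟶ Y) (g : Y ⟶ Z) :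
    transpose (f ≫ g) = transpose g ≫ transpose f := by
  apply hom_ext
  intro q p
  by_cases h : p.Matched q
  · refine Finset.sum_congr ?_ fun r _ => mul_comm _ _
    ext r
    rw [LabeledGraph.Path.mem_matching, LabeledGraph.Path.mem_matching]
    exact ⟨h.symm.trans, h.trans⟩
  · rw [Hom.vanish _ q p fun h' => h h'.symm, Hom.vanish _ q p fun h' => h h'.symm]

theorem transpose_triangle : transpose (triangle X Y) = triangle Y X := by
  classical
  exact hom_ext fun _ _ => if_congr LabeledGraph.Path.boundsCycle_comm rfl rfl

/-- The tensor product of two morphisms, between objects that are only propositionally equal to the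
tensor products of the sources and of the targets. -/
noncomputable def tensorHomOf {X' Y' : GPA k Γ} (h : W = tensorObj X X')
    (h' : Z = tensorObj Y Y') (f : X ⟶ Y) (g : X' ⟶ Y') : W ⟶ Z :=
  eqToHom h ≫ tensorHom f g ≫ eqToHom h'.symm

theorem tensorHomOf_rfl {X' Y' : GPA k Γ} (f : X ⟶ Y) (g : X' ⟶ Y') :
    tensorHomOf rfl rfl f g = tensorHom f g := by
  simp only [tensorHomOf, eqToHom_refl, Category.id_comp, Category.comp_id]

variable {X' Y' Z' W' W'' : GPA k Γ}

theorem tensorHom_comp_eqToHom (h : W = tensorObj X X') (h' : Z = tensorObj Y Y') (f : X ⟶ Y)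
    (g : X' ⟶ Y') : tensorHom f g ≫ eqToHom h'.symm = eqToHom h.symm ≫ tensorHomOf h h' f g := by
  subst h h'
  rw [tensorHomOf_rfl, eqToHom_refl, eqToHom_refl, Category.comp_id, Category.id_comp]

theorem transpose_tensorHomOf (h : W = tensorObj X X') (h' : Z = tensorObj Y Y') (f : X ⟶ Y)
    (g : X' ⟶ Y') :
    transpose (tensorHomOf h h' f g) = tensorHomOf h' h (transpose f) (transpose g) := by
  subst h h'
  rw [tensorHomOf_rfl, tensorHomOf_rfl]
  rfl

theorem tensorHomOf_add (h : W = tensorObj X X') (h' : Z = tensorObj Y Y') (f : X ⟶ Y)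
    (g g' : X' ⟶ Y') :
    tensorHomOf h h' f (g + g') = tensorHomOf h h' f g + tensorHomOf h h' f g' := by
  subst h h'
  simp only [tensorHomOf_rfl]
  exact hom_ext fun _ _ => mul_add _ _ _

theorem add_tensorHomOf (h : W = tensorObj X X') (h' : Z = tensorObj Y Y') (f f' : X ⟶ Y)
    (g : X' ⟶ Y') :
    tensorHomOf h h' (f + f') g = tensorHomOf h h' f g + tensorHomOf h h' f' g := by
  subst h h'
  simp only [tensorHomOf_rfl]
  exact hom_ext fun _ _ => add_mul _ _ _

theorem tensorHomOf_smul (h : W = tensorObj X X') (h' : Z = tensorObj Y Y') (f : X ⟶ Y) (r : k)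
    (g : X' ⟶ Y') : tensorHomOf h h' f (r • g) = r • tensorHomOf h h' f g := by
  subst h h'
  simp only [tensorHomOf_rfl]
  exact hom_ext fun _ _ => mul_left_comm _ _ _

theorem smul_tensorHomOf (h : W = tensorObj X X') (h' : Z = tensorObj Y Y') (r : k) (f : X ⟶ Y)
    (g : X' ⟶ Y') : tensorHomOf h h' (r • f) g = r • tensorHomOf h h' f g := by
  subst h h'
  simp only [tensorHomOf_rfl]
  exact hom_ext fun _ _ => mul_assoc _ _ _

theorem tensorHomOf_zero (h : W = tensorObj X X') (h' : Z = tensorObj Y Y') (f : X ⟶ Y) :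
    tensorHomOf h h' f (0 : X' ⟶ Y') = 0 := by
  rw [← zero_smul k (0 : X' ⟶ Y'), tensorHomOf_smul, zero_smul]

theorem zero_tensorHomOf (h : W = tensorObj X X') (h' : Z = tensorObj Y Y') (g : X' ⟶ Y') :
    tensorHomOf h h' (0 : X ⟶ Y) g = 0 := by
  rw [← zero_smul k (0 : X ⟶ Y), smul_tensorHomOf, zero_smul]

theorem tensorHomOf_comp (h : W = tensorObj X X') (h' : W' = tensorObj Y Y')
    (h'' : W'' = tensorObj Z Z') (f : X ⟶ Y) (g : Y ⟶ Z) (f' : X' ⟶ Y') (g' : Y' ⟶ Z') :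
    tensorHomOf h h'' (f ≫ g) (f' ≫ g') = tensorHomOf h h' f f' ≫ tensorHomOf h' h'' g g' := by
  subst h h' h''
  simp only [tensorHomOf_rfl, tensorHom_comp]

theorem tensorHomOf_id (h : W = tensorObj X Y) : tensorHomOf h h (𝟙 X) (𝟙 Y) = 𝟙 W := by
  subst h
  rw [tensorHomOf_rfl, tensorHom_id]

theorem tensorHomOf_assoc {XY YZ XY' YZ' W₁ W₂ W₁' W₂' : GPA k Γ}
    (hXY : XY = tensorObj X Y) (hYZ : YZ = tensorObj Y Z) (hXY' : XY' = tensorObj X' Y')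
    (hYZ' : YZ' = tensorObj Y' Z') (h₁ : W₁ = tensorObj XY Z) (h₁' : W₁' = tensorObj XY' Z')
    (h₂ : W₂ = tensorObj X YZ) (h₂' : W₂' = tensorObj X' YZ') (e : W₂ = W₁) (e' : W₁' = W₂')
    (f : X ⟶ X') (g : Y ⟶ Y') (h : Z ⟶ Z') :
    eqToHom e ≫ tensorHomOf h₁ h₁' (tensorHomOf hXY hXY' f g) h ≫ eqToHom e' =
      tensorHomOf h₂ h₂' f (tensorHomOf hYZ hYZ' g h) := by
  subst hXY hYZ hXY' hYZ' h₁ h₁' h₂ h₂'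
  simp only [tensorHomOf_rfl]
  rw [tensorHom_assoc, eqToHom_trans_assoc, eqToHom_refl, Category.id_comp]

theorem tensorHomOf_id_nil (h : W = tensorObj X ⟨[]⟩) (h' : Z = tensorObj Y ⟨[]⟩) (e : X = W)
    (e' : Z = Y) (f : X ⟶ Y) :
    eqToHom e ≫ tensorHomOf h h' f (𝟙 (⟨[]⟩ : GPA k Γ)) ≫ eqToHom e' = f := by
  subst h h'
  rw [tensorHomOf_rfl, tensorHom_unit_right, eqToHom_trans_assoc, eqToHom_refl, Category.id_comp]

theorem tensorHomOf_nil_id (f : X ⟶ Y) :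
    tensorHomOf (nil_tensorObj X).symm (nil_tensorObj Y).symm (𝟙 (⟨[]⟩ : GPA k Γ)) f = f :=
  (tensorHomOf_rfl _ _).trans
    ((Category.comp_id _).symm.trans ((tensorHom_unit_left f).trans (Category.id_comp _)))

section

open MonoidalCategory

theorem associator_hom (X Y Z : GPA k Γ) :
    (α_ X Y Z).hom = eqToHom (show (X ⊗ Y) ⊗ Z = X ⊗ Y ⊗ Z from tensorObj_assoc X Y Z) :=
  rfl

theorem leftUnitor_hom (X : GPA k Γ) :
    (λ_ X).hom = eqToHom (show 𝟙_ (GPA k Γ) ⊗ X = X from nil_tensorObj X) :=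
  rfl

theorem rightUnitor_hom (X : GPA k Γ) :
    (ρ_ X).hom = eqToHom (show X ⊗ 𝟙_ (GPA k Γ) = X from tensorObj_nil X) :=
  rfl

end

end GPA

/-! ## Morphisms given by matrices indexed by lists of subsets -/

/-- The morphism `φ` of the graph planar algebra of the weight lattice takes the value `M s t` on
the pairs of paths with common source traced by lists of subsets `s` and `t` with cardinalities `c`
and `d`. The values of `M` on other lists are irrelevant. -/
structure Represents {k : Type u} [Field k] {n : ℕ} (c d : List ℕ) {X Y : GPA k (weightGraph n)}
    (φ : X ⟶ Y) (M : List (Finset (Fin n)) → List (Finset (Fin n)) → k) : Prop where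
  source : X.seq = edgeLabels n c
  target : Y.seq = edgeLabels n d
  toFun_eq {s t : List (Finset (Fin n))} (hs : s.map Finset.card = c) (ht : t.map Finset.card = d)
    {p : (weightGraph n).Path X.seq} {q : (weightGraph n).Path Y.seq} (hsrc : p.src = q.src)
    (hp : p.rest = walkOf p.src s) (hq : q.rest = walkOf q.src t) : φ.toFun p q = M s t

namespace Represents

variable {k : Type u} [Field k] {n : ℕ} {c d e c' d' : List ℕ}
  {X Y Z X' Y' : GPA k (weightGraph n)} {φ ψ : X ⟶ Y}
  {M N : List (Finset (Fin n)) → List (Finset (Fin n)) → k}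

theorem congr (h : Represents c d φ M) (hMN : ∀ s t, s.map Finset.card = c →
    t.map Finset.card = d → M s t = N s t) : Represents c d φ N :=
  ⟨h.source, h.target, fun hs ht _ _ hsrc hp hq =>
    (h.toFun_eq hs ht hsrc hp hq).trans (hMN _ _ hs ht)⟩

theorem cast (h : Represents c d φ M) (hc : c = c') (hd : d = d') : Represents c' d' φ M := by
  subst hc hd
  exact h

theorem hom_eq (hφ : Represents c d φ M) (hψ : Represents c d ψ N) (hc : ∀ a ∈ c, a ≤ n)
    (hd : ∀ a ∈ d, a ≤ n)
    (h : ∀ s t, s.map Finset.card = c → t.map Finset.card = d →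
      totalWeight s = totalWeight t → M s t = N s t) : φ = ψ := by
  refine GPA.hom_ext fun p q => ?_
  by_cases hpq : p.Matched q
  · obtain ⟨s, hs, hp⟩ := exists_rest_eq_walkOf hc hφ.source p
    obtain ⟨t, ht, hq⟩ := exists_rest_eq_walkOf hd hφ.target q
    rw [hφ.toFun_eq hs ht hpq.1 hp hq, hψ.toFun_eq hs ht hpq.1 hp hq]
    have htgt : p.rest.getLastD p.src = q.rest.getLastD q.src := hpq.2
    rw [hp, hq, getLastD_walkOf, getLastD_walkOf, hpq.1] at htgt
    exact h s t hs ht (add_left_cancel htgt)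
  · rw [GPA.Hom.vanish φ p q hpq, GPA.Hom.vanish ψ p q hpq]

theorem comp {χ : Y ⟶ Z} (hφ : Represents c d φ M) (hχ : Represents d e χ N)
    (hd : ∀ a ∈ d, a ≤ n) :
    Represents c e (φ ≫ χ) fun s t => ∑ r ∈ ofCards n d, M s r * N r t := by
  refine ⟨hφ.source, hχ.target, fun {s t} hs ht p q hsrc hp hq => ?_⟩
  have hY : ∀ r ∈ ofCards n d, Y.seq = edgeLabels n (r.map Finset.card) := fun r hr => by
    rw [hφ.target, mem_ofCards.1 hr]
  have hentry : ∀ r (hr : r ∈ ofCards n d), φ.toFun p (tracePath p.src r (hY r hr)) = M s r :=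
    fun r hr => hφ.toFun_eq hs (mem_ofCards.1 hr) rfl hp rfl
  rw [GPA.comp_toFun]
  symm
  refine Finset.sum_bij_ne_zero (fun r hr _ => tracePath p.src r (hY r hr)) ?_ ?_ ?_ ?_
  · intro r hr hne
    rw [LabeledGraph.Path.mem_matching]
    by_contra hmatch
    rw [← hentry r hr, GPA.Hom.vanish φ _ _ hmatch, zero_mul] at hne
    exact hne rfl
  · intro r hr _ r' hr' _ h
    exact walkOf_injOn ((mem_ofCards.1 hr).trans (mem_ofCards.1 hr').symm)
      (congrArg LabeledGraph.Path.rest h)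
  · intro p' hp' hne
    obtain ⟨r, hr, hrest⟩ := exists_rest_eq_walkOf hd hφ.target p'
    have hsrc' := (LabeledGraph.Path.mem_matching.1 hp').1
    refine ⟨r, mem_ofCards.2 hr, ?_, LabeledGraph.Path.ext hsrc' ?_⟩
    · rwa [← hφ.toFun_eq hs hr hsrc' hp hrest, ← hχ.toFun_eq hr ht (hsrc' ▸ hsrc) hrest hq]
    · rw [hrest, ← hsrc']
      rfl
  · intro r hr _
    rw [hentry r hr, hχ.toFun_eq (mem_ofCards.1 hr) ht hsrc rfl hq]

theorem tensorHom {φ' : X' ⟶ Y'} (hφ : Represents c d φ M) (hφ' : Represents c' d' φ' N) :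
    Represents (c ++ c') (d ++ d') (GPA.tensorHom φ φ') fun s t =>
      M (s.take c.length) (t.take d.length) * N (s.drop c.length) (t.drop d.length) := by
  refine ⟨?_, ?_, fun {s t} hs ht p q hsrc hp hq => ?_⟩
  · rw [edgeLabels_append, ← hφ.source, ← hφ'.source]
    rfl
  · rw [edgeLabels_append, ← hφ.target, ← hφ'.target]
    rfl
  have hleft := hφ.toFun_eq (s := s.take c.length) (t := t.take d.length)
    (by simp [List.map_take, hs]) (by simp [List.map_take, ht]) (p := p.left X.seq X'.seq)
    (q := q.left Y.seq Y'.seq) hsrc (left_rest_eq_walkOf hs hφ.source hp)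
    (left_rest_eq_walkOf ht hφ.target hq)
  change φ.toFun (p.left X.seq X'.seq) (q.left Y.seq Y'.seq) *
    φ'.toFun (p.right X.seq X'.seq) (q.right Y.seq Y'.seq) = _
  rw [hleft]
  by_cases hmatch : (p.left X.seq X'.seq).Matched (q.left Y.seq Y'.seq)
  · rw [hφ'.toFun_eq (s := s.drop c.length) (t := t.drop d.length)
      (by simp [List.map_drop, hs]) (by simp [List.map_drop, ht]) hmatch.2
      (right_rest_eq_walkOf hs hφ.source hp) (right_rest_eq_walkOf ht hφ.target hq)]
  · rw [← hleft, GPA.Hom.vanish φ _ _ hmatch, zero_mul, zero_mul]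

theorem id (h : X.seq = edgeLabels n c) :
    Represents c c (𝟙 X) fun s t => if s = t then 1 else 0 := by
  classical
  refine ⟨h, h, fun hs ht p q hsrc hp hq => if_congr ⟨?_, ?_⟩ rfl rfl⟩
  · rintro rfl
    exact walkOf_injOn (hs.trans ht.symm) (hp.symm.trans hq)
  · rintro rfl
    exact LabeledGraph.Path.ext hsrc (by rw [hp, hq, hsrc])

theorem zero (h : X.seq = edgeLabels n c) (h' : Y.seq = edgeLabels n d) :
    Represents c d (0 : X ⟶ Y) fun _ _ => 0 :=
  ⟨h, h', fun _ _ _ _ _ _ _ => rfl⟩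

theorem add (hφ : Represents c d φ M) (hψ : Represents c d ψ N) :
    Represents c d (φ + ψ) fun s t => M s t + N s t :=
  ⟨hφ.source, hφ.target, fun hs ht p q hsrc hp hq => by
    rw [GPA.add_toFun, hφ.toFun_eq hs ht hsrc hp hq, hψ.toFun_eq hs ht hsrc hp hq]⟩

theorem smul (r : k) (hφ : Represents c d φ M) : Represents c d (r • φ) fun s t => r * M s t :=
  ⟨hφ.source, hφ.target, fun hs ht p q hsrc hp hq => by
    rw [GPA.smul_toFun, hφ.toFun_eq hs ht hsrc hp hq]⟩

theorem transpose (hφ : Represents c d φ M) :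
    Represents d c (GPA.transpose φ) fun s t => M t s :=
  ⟨hφ.target, hφ.source, fun hs ht _ _ hsrc hp hq => hφ.toFun_eq ht hs hsrc.symm hq hp⟩

theorem tensorHomOf {W W' : GPA k (weightGraph n)} {φ' : X' ⟶ Y'} (hφ : Represents c d φ M)
    (hφ' : Represents c' d' φ' N) (h : W = GPA.tensorObj X X') (h' : W' = GPA.tensorObj Y Y') :
    Represents (c ++ c') (d ++ d') (GPA.tensorHomOf h h' φ φ') fun s t =>
      M (s.take c.length) (t.take d.length) * N (s.drop c.length) (t.drop d.length) := by
  subst h h'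
  rw [GPA.tensorHomOf_rfl]
  exact hφ.tensorHom hφ'

theorem zero_cons (hφ : Represents c d φ M) : Represents (0 :: c) d φ fun s => M s.tail := by
  refine ⟨?_, hφ.target, fun hs ht p q hsrc hp hq => ?_⟩
  · rw [hφ.source, edgeLabels_cons_of_neg (by simp)]
  · obtain ⟨A, s, rfl, hA, hs⟩ := List.map_eq_cons_iff.1 hs
    exact hφ.toFun_eq hs ht hsrc (hp.trans (walkOf_cons_of_neg (by omega) _ _)) hq

theorem concat_zero (hφ : Represents c d φ M) :
    Represents (c ++ [0]) d φ fun s => M s.dropLast := by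
  refine ⟨?_, hφ.target, fun hs ht p q hsrc hp hq => ?_⟩
  · rw [hφ.source, edgeLabels_append, edgeLabels_cons_of_neg (by simp)]
    exact (List.append_nil _).symm
  · obtain ⟨s, r, rfl, hcards, hr⟩ := List.map_eq_append_iff.1 hs
    obtain ⟨A, rfl, hA⟩ := List.map_eq_singleton_iff.1 hr
    rw [walkOf_append, walkOf_cons_of_neg (by omega), walkOf, List.append_nil] at hp
    rw [List.dropLast_concat]
    exact hφ.toFun_eq hcards ht hsrc hp hq

end Represents

/-! ## Evaluation of formal webs -/

namespace PreWeb

variable {k : Type u} {n : ℕ} {a b a' b' : List (WebLabel n)}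

theorem mk_reduceSeq_append (a b : List (WebLabel n)) :
    (⟨reduceSeq (a ++ b)⟩ : GPA k (weightGraph n)) =
      GPA.tensorObj ⟨reduceSeq a⟩ ⟨reduceSeq b⟩ :=
  congrArg GPA.mk (reduceSeq_append a b)

/-- The reflection of a formal web in a horizontal line. -/
def reflect {a b : List (WebLabel n)} : PreWeb k n a b → PreWeb k n b a
  | id a => id a
  | comp f g => comp g.reflect f.reflect
  | tensor f g => tensor f.reflect g.reflect
  | zero => zero
  | add f g => add f.reflect g.reflect
  | smul r f => smul r f.reflect
  | merge i j h => split i j h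
  | split i j h => merge i j h
  | dot hn => codot hn
  | codot hn => dot hn

theorem reflect_cast (h : a = a') (h' : b = b') (f : PreWeb k n a b) :
    (f.cast h h').reflect = f.reflect.cast h' h := by
  subst h h'
  rfl

theorem cast_comp {c : List (WebLabel n)} (h : b = b') (f : PreWeb k n a b)
    (g : PreWeb k n b' c) : comp (f.cast rfl h) g = comp f (g.cast h.symm rfl) := by
  subst h
  rfl

theorem reflect_mergeNat (i j : ℕ) : (mergeNat k n i j).reflect = splitNat k n i j := by
  unfold mergeNat splitNat
  split_ifs <;> first | rw [reflect_cast]; rfl | rfl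

theorem reflect_splitNat (i j : ℕ) : (splitNat k n i j).reflect = mergeNat k n i j := by
  unfold mergeNat splitNat
  split_ifs <;> first | rw [reflect_cast]; rfl | rfl

theorem reflect_rungRight (m l m' l' r : ℕ) :
    (rungRight k n m l m' l' r).reflect = rungLeft k n m' l' m l r := by
  unfold rungRight rungLeft
  split_ifs with h h' h'
  · obtain ⟨rfl, rfl⟩ := h
    simp only [reflect, reflect_cast, reflect_splitNat, reflect_mergeNat]
  · exact absurd ⟨h.2, h.1⟩ h'
  · exact absurd ⟨h'.2, h'.1⟩ h
  · rfl

theorem reflect_cap (i j : WebLabel n) (h : i.1 + j.1 = n) :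
    (cap k i j h).reflect = cup k i j h := by
  simp only [cap, cup, reflect, reflect_cast, cast_comp]

theorem reflect_cup (i j : WebLabel n) (h : i.1 + j.1 = n) :
    (cup k i j h).reflect = cap k i j h := by
  simp only [cap, cup, reflect, reflect_cast, cast_comp]

variable [Field k]

/-- The morphism of the graph planar algebra assigned to a formal web: every vertex is sent to a
triangle indicator map. -/
noncomputable def eval {a b : List (WebLabel n)} :
    PreWeb k n a b → ((⟨reduceSeq a⟩ : GPA k (weightGraph n)) ⟶ ⟨reduceSeq b⟩)
  | id _ => 𝟙 _
  | comp f g => f.eval ≫ g.eval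
  | tensor f g =>
      GPA.tensorHomOf (mk_reduceSeq_append _ _) (mk_reduceSeq_append _ _) f.eval g.eval
  | zero => 0
  | add f g => f.eval + g.eval
  | smul r f => r • f.eval
  | merge _ _ _ => GPA.triangle _ _
  | split _ _ _ => GPA.triangle _ _
  | dot _ => GPA.triangle _ _
  | codot _ => GPA.triangle _ _

theorem eval_cast (h : a = a') (h' : b = b') (f : PreWeb k n a b) :
    (f.cast h h').eval = eqToHom (by rw [h]) ≫ f.eval ≫ eqToHom (by rw [h']) := by
  subst h h'
  simp [cast]

theorem eval_reflect (f : PreWeb k n a b) : f.reflect.eval = GPA.transpose f.eval := by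
  induction f with
  | id a => exact GPA.transpose_id.symm
  | comp f g hf hg =>
    rw [reflect, eval, hf, hg]
    exact (GPA.transpose_comp _ _).symm
  | tensor f g hf hg =>
    rw [reflect, eval, hf, hg]
    exact (GPA.transpose_tensorHomOf _ _ _ _).symm
  | zero => rfl
  | add f g hf hg =>
    rw [reflect, eval, hf, hg]
    rfl
  | smul r f hf =>
    rw [reflect, eval, hf]
    rfl
  | merge i j h => exact GPA.transpose_triangle.symm
  | split i j h => exact GPA.transpose_triangle.symm
  | dot hn => exact GPA.transpose_triangle.symm
  | codot hn => exact GPA.transpose_triangle.symm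

end PreWeb

/-! ## The vertices -/

section Vertices

variable {n : ℕ}

theorem subsetWeight_add_eq_iff {A B C : Finset (Fin n)} (h : A.card + B.card = C.card) :
    subsetWeight n A + subsetWeight n B = subsetWeight n C ↔ Disjoint A B ∧ A ∪ B = C := by
  have hcover := totalWeight_eq_iff_coverCount_eq (s := [A, B]) (t := [C]) (by simpa using h)
  simp only [totalWeight_cons, totalWeight_nil, add_zero] at hcover
  simp only [hcover, coverCount_cons, coverCount_nil, Finset.disjoint_left, Finset.ext_iff,
    Finset.mem_union, ← forall_and]
  exact forall_congr' fun i => by grind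

/-- The matrix of a merge vertex: the third set is the disjoint union of the first two. -/
def mergeMatrix (k : Type*) [Zero k] [One k] {α : Type*} [DecidableEq α] :
    List (Finset α) → List (Finset α) → k
  | [A, B], [C] => if Disjoint A B ∧ A ∪ B = C then 1 else 0
  | _, _ => 0

theorem boundsCycle_merge_iff {σ τ : List (EdgeLabel n)} {p : (weightGraph n).Path σ}
    {q : (weightGraph n).Path τ} {A B C : Finset (Fin n)} (hA : A.Nonempty) (hB : B.Nonempty)
    (hcard : A.card + B.card = C.card) (hsrc : p.src = q.src) (hp : p.rest = walkOf p.src [A, B])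
    (hq : q.rest = walkOf q.src [C]) : p.BoundsCycle q ↔ Disjoint A B ∧ A ∪ B = C := by
  rw [← Finset.card_pos] at hA hB
  have hCn : C.card ≤ n := by simpa using C.card_le_univ
  have hA' : 1 ≤ A.card ∧ A.card < n := by omega
  have hB' : 1 ≤ B.card ∧ B.card < n := by omega
  have hA0 : subsetWeight n A ≠ 0 := fun h => subsetWeight_eq_zero_iff.1 h hA'
  have hB0 : subsetWeight n B ≠ 0 := fun h => subsetWeight_eq_zero_iff.1 h hB'
  have hmatched : p.Matched q ↔ Disjoint A B ∧ A ∪ B = C := by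
    rw [← subsetWeight_add_eq_iff hcard, LabeledGraph.Path.Matched, and_iff_right hsrc,
      LabeledGraph.Path.tgt, LabeledGraph.Path.tgt, hp, hq, getLastD_walkOf, getLastD_walkOf, hsrc,
      add_right_inj, totalWeight_cons, totalWeight_cons, totalWeight_cons, totalWeight_nil,
      add_zero, add_zero]
  rw [← hmatched]
  refine and_iff_left_of_imp fun h => ?_
  have hsum := (subsetWeight_add_eq_iff hcard).2 (hmatched.1 h)
  rw [LabeledGraph.Path.verts, LabeledGraph.Path.verts, hp, hq, hsrc, walkOf_cons_of_pos hA',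
    walkOf_cons_of_pos hB', walkOf]
  by_cases hC : 1 ≤ C.card ∧ C.card < n
  · have hC0 : subsetWeight n C ≠ 0 := fun h => subsetWeight_eq_zero_iff.1 h hC
    have hAC : subsetWeight n A ≠ subsetWeight n C := fun h => hB0 (by simpa [← hsum] using h)
    rw [walkOf_cons_of_pos hC, walkOf]
    simp [hA0, hC0, hAC]
  · rw [walkOf_cons_of_neg hC, walkOf]
    simp [hA0]

theorem exists_eq_pair_of_map_card {α : Type*} {a b : ℕ} {s : List (Finset α)}
    (h : s.map Finset.card = [a, b]) : ∃ A B, s = [A, B] ∧ A.card = a ∧ B.card = b := by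
  obtain ⟨A, s, rfl, hA, h⟩ := List.map_eq_cons_iff.1 h
  obtain ⟨B, rfl, hB⟩ := List.map_eq_singleton_iff.1 h
  exact ⟨A, B, rfl, hA, hB⟩

theorem exists_eq_triple_of_map_card {α : Type*} {a b c : ℕ} {s : List (Finset α)}
    (h : s.map Finset.card = [a, b, c]) :
    ∃ A B C, s = [A, B, C] ∧ A.card = a ∧ B.card = b ∧ C.card = c := by
  obtain ⟨A, s, rfl, hA, h⟩ := List.map_eq_cons_iff.1 h
  obtain ⟨B, C, rfl, hB, hC⟩ := exists_eq_pair_of_map_card h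
  exact ⟨A, B, C, rfl, hA, hB, hC⟩

end Vertices

namespace PreWeb

variable {k : Type u} [Field k] {n : ℕ} {a b a' b' : List (WebLabel n)} {c d c' d' : List ℕ}
  {M N : List (Finset (Fin n)) → List (Finset (Fin n)) → k}

theorem represents_cast (h : a = a') (h' : b = b') {f : PreWeb k n a b}
    (hf : Represents c d f.eval M) : Represents c d (f.cast h h').eval M := by
  subst h h'
  exact hf

theorem represents_tensor {f : PreWeb k n a b} {g : PreWeb k n a' b'}
    (hf : Represents c d f.eval M) (hg : Represents c' d' g.eval N) :
    Represents (c ++ c') (d ++ d') (tensor f g).eval fun s t =>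
      M (s.take c.length) (t.take d.length) * N (s.drop c.length) (t.drop d.length) :=
  hf.tensorHomOf hg _ _

theorem represents_reflect {f : PreWeb k n a b} (hf : Represents c d f.eval M) :
    Represents d c f.reflect.eval fun s t => M t s := by
  rw [eval_reflect]
  exact hf.transpose

theorem represents_id_label (i : WebLabel n) :
    Represents [i.1] [i.1] (id (k := k) [i]).eval fun s t => if s = t then 1 else 0 :=
  Represents.id (reduceSeq_eq_edgeLabels _)

theorem represents_id_strand (a : ℕ) :
    Represents [a] [a] (id (k := k) (strand n a)).eval fun s t => if s = t then 1 else 0 :=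
  Represents.id (reduceSeq_strand _)

theorem represents_sum {f : ℕ → PreWeb k n a b}
    {M : ℕ → List (Finset (Fin n)) → List (Finset (Fin n)) → k} (hc : reduceSeq a = edgeLabels n c)
    (hd : reduceSeq b = edgeLabels n d) (N : ℕ) (hf : ∀ t < N, Represents c d (f t).eval (M t)) :
    Represents c d (PreWeb.sum f N).eval fun s t => ∑ m ∈ Finset.range N, M m s t := by
  induction N with
  | zero => exact Represents.zero hc hd
  | succ N ih =>
    exact ((ih fun t ht => hf t (ht.trans N.lt_succ_self)).add (hf N N.lt_succ_self)).congr
      fun s t _ _ => (Finset.sum_range_succ _ _).symm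

theorem represents_merge (i j : WebLabel n) (h : i.1 + j.1 ≤ n) :
    Represents [i.1, j.1] [i.1 + j.1] (merge i j h).eval (mergeMatrix k) := by
  classical
  refine ⟨reduceSeq_eq_edgeLabels _, reduceSeq_eq_edgeLabels _,
    fun {s t} hs ht p q hsrc hp hq => ?_⟩
  obtain ⟨A, B, rfl, hA, hB⟩ := exists_eq_pair_of_map_card hs
  obtain ⟨C, rfl, hC⟩ := List.map_eq_singleton_iff.1 ht
  have hA0 : A.Nonempty := Finset.card_pos.1 (hA ▸ i.2.1)
  have hB0 : B.Nonempty := Finset.card_pos.1 (hB ▸ j.2.1)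
  exact if_congr (boundsCycle_merge_iff hA0 hB0 (by omega) hsrc hp hq) rfl rfl

theorem represents_split (i j : WebLabel n) (h : i.1 + j.1 ≤ n) :
    Represents [i.1 + j.1] [i.1, j.1] (split (k := k) i j h).eval fun s t => mergeMatrix k t s :=
  represents_reflect (represents_merge i j h)

theorem represents_dot (hn : 1 ≤ n) : Represents [n] [] (dot (k := k) hn).eval fun _ _ => 1 := by
  refine ⟨reduceSeq_eq_edgeLabels _, reduceSeq_eq_edgeLabels _,
    fun {s t} hs ht p q hsrc hp hq => ?_⟩
  obtain ⟨A, rfl, hA⟩ := List.map_eq_singleton_iff.1 hs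
  obtain rfl := List.map_eq_nil_iff.1 ht
  rw [walkOf_cons_of_neg (by omega)] at hp
  refine if_pos ⟨⟨hsrc, ?_⟩, ?_⟩
  · simp [LabeledGraph.Path.tgt, hp, hq, hsrc, walkOf]
  · simp [LabeledGraph.Path.verts, hp, hq, walkOf]

theorem represents_codot (hn : 1 ≤ n) :
    Represents [] [n] (codot (k := k) hn).eval fun _ _ => 1 :=
  represents_reflect (represents_dot hn)

theorem reduceSeq_strand_append_strand (a b : ℕ) :
    reduceSeq (strand n a ++ strand n b) = edgeLabels n [a, b] := by
  rw [reduceSeq_append, reduceSeq_strand, reduceSeq_strand, ← edgeLabels_append,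
    List.singleton_append]

theorem represents_mergeNat (a b : ℕ) :
    Represents [a, b] [a + b] (mergeNat k n a b).eval (mergeMatrix k) := by
  unfold mergeNat
  split_ifs with h ha hb
  · subst ha
    rw [show [0, b] = 0 :: [0 + b] by rw [zero_add]]
    refine represents_cast _ _ ((represents_id_strand _).zero_cons.congr fun s t hs ht => ?_)
    obtain ⟨A, B, rfl, hA, -⟩ := exists_eq_pair_of_map_card hs
    obtain ⟨C, rfl, -⟩ := List.map_eq_singleton_iff.1 ht
    obtain rfl := Finset.card_eq_zero.1 hA
    simp [mergeMatrix]
  · subst hb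
    refine represents_cast _ _ ((represents_id_strand a).concat_zero.congr fun s t hs ht => ?_)
    obtain ⟨A, B, rfl, -, hB⟩ := exists_eq_pair_of_map_card hs
    obtain ⟨C, rfl, -⟩ := List.map_eq_singleton_iff.1 ht
    obtain rfl := Finset.card_eq_zero.1 hB
    simp [mergeMatrix]
  · exact represents_cast _ _ (represents_merge ⟨a, _⟩ ⟨b, _⟩ h)
  · refine (Represents.zero (reduceSeq_strand_append_strand a b) (reduceSeq_strand _)).congr
      fun s t _ ht => ?_
    obtain ⟨C, rfl, hC⟩ := List.map_eq_singleton_iff.1 ht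
    have hCn : C.card ≤ n := by simpa using C.card_le_univ
    omega

theorem represents_splitNat (a b : ℕ) :
    Represents [a + b] [a, b] (splitNat k n a b).eval fun s t => mergeMatrix k t s := by
  rw [← reflect_mergeNat]
  exact represents_reflect (represents_mergeNat a b)

end PreWeb

/-! ## Counting subsets in intervals -/

section Counting

variable {α β : Type*} [DecidableEq α] [DecidableEq β] {A B A' B' P Q X Y : Finset α} {r i j : ℕ}

theorem indicator_mul_indicator {R : Type*} [MulZeroOneClass R] (p q : Prop) [Decidable p]
    [Decidable q] :
    (if p then (1 : R) else 0) * (if q then 1 else 0) = if p ∧ q then 1 else 0 := by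
  rw [ite_zero_mul_ite_zero, one_mul]

theorem sum_eq_indicator {R : Type*} [AddCommMonoid R] [One R] {S : Finset β} {f : β → R} (x : β)
    (p : Prop) [Decidable p] (hf : ∀ y ∈ S, f y = if y = x ∧ p then 1 else 0) (hx : p → x ∈ S) :
    ∑ y ∈ S, f y = if p then 1 else 0 := by
  rw [Finset.sum_congr rfl hf]
  split_ifs with hp
  · simp only [hp, and_true, Finset.sum_ite_eq', hx hp, if_true]
  · simp only [hp, and_false, if_false, Finset.sum_const_zero]

theorem sum_sum_indicator_eq_card {β γ R : Type*} [Semiring R] {S F : Finset β} {T : Finset γ}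
    {p : β → γ → Prop} [∀ x y, Decidable (p x y)] (g : β → γ)
    (hp : ∀ x y, p x y ↔ x ∈ F ∧ y = g x) (hS : ∀ x y, p x y → x ∈ S ∧ y ∈ T) :
    ∑ x ∈ S, ∑ y ∈ T, (if p x y then (1 : R) else 0) = F.card := by
  classical
  have hinner : ∀ x ∈ S, ∑ y ∈ T, (if p x y then (1 : R) else 0) = if x ∈ F then 1 else 0 :=
    fun x _ => sum_eq_indicator (g x) _ (fun y _ => if_congr ((hp x y).trans and_comm) rfl rfl)
      fun hx => (hS x _ ((hp x _).2 ⟨hx, rfl⟩)).2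
  have hF : S.filter (· ∈ F) = F := by
    ext x
    rw [Finset.mem_filter, and_iff_right_iff_imp]
    exact fun hx => (hS x _ ((hp x _).2 ⟨hx, rfl⟩)).1
  rw [Finset.sum_congr rfl hinner, Finset.sum_boole, hF]

theorem card_filter_Icc_card_eq_add (h : X ⊆ Y) (K : ℕ) :
    ((Finset.Icc X Y).filter fun P => P.card = X.card + K).card =
      (Y.card - X.card).choose K := by
  rw [← Finset.card_sdiff_of_subset h, ← Finset.card_powersetCard]
  have hdisj : ∀ {P : Finset α}, P ⊆ Y \ X → Disjoint X P := fun hP =>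
    Finset.disjoint_of_subset_right hP Finset.disjoint_sdiff
  symm
  refine Finset.card_nbij' (X ∪ ·) (· \ X) (fun P hP => ?_) (fun P hP => ?_) (fun P hP => ?_)
    fun P hP => ?_
  · simp only [Finset.coe_filter, Finset.mem_Icc, Set.mem_ofPred_eq, Finset.mem_coe,
      Finset.mem_powersetCard] at hP ⊢
    rw [Finset.card_union_of_disjoint (hdisj hP.1), hP.2]
    exact ⟨⟨Finset.subset_union_left,
      Finset.union_subset h (hP.1.trans Finset.sdiff_subset)⟩, rfl⟩
  · simp only [Finset.coe_filter, Finset.mem_Icc, Set.mem_ofPred_eq, Finset.mem_coe,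
      Finset.mem_powersetCard] at hP ⊢
    rw [Finset.card_sdiff_of_subset hP.1.1, hP.2, Nat.add_sub_cancel_left]
    exact ⟨Finset.sdiff_subset_sdiff hP.1.2 le_rfl, rfl⟩
  · exact Finset.union_sdiff_cancel_left (hdisj (Finset.mem_powersetCard.1 hP).1)
  · exact Finset.union_sdiff_of_subset (Finset.mem_Icc.1 (Finset.mem_filter.1 hP).1).1

theorem card_filter_Icc_card_add_eq (h : X ⊆ Y) (K : ℕ) :
    ((Finset.Icc X Y).filter fun P => P.card + K = Y.card).card = (Y.card - X.card).choose K := by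
  have hXY := Finset.card_le_card h
  by_cases hK : K ≤ Y.card - X.card
  · rw [← Nat.choose_symm hK, ← card_filter_Icc_card_eq_add h]
    exact congrArg Finset.card (Finset.filter_congr fun P _ => by omega)
  · rw [Nat.choose_eq_zero_of_lt (not_le.1 hK), Finset.card_eq_zero, Finset.filter_eq_empty_iff]
    intro P hP
    have hXP := Finset.card_le_card (Finset.mem_Icc.1 hP).1
    omega

theorem card_filter_Icc_card_eq_zero {m : ℕ} (hm : m < X.card) :
    ((Finset.Icc X Y).filter fun P => P.card = m).card = 0 := by
  rw [Finset.card_eq_zero, Finset.filter_eq_empty_iff]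
  intro P hP hPm
  exact hm.not_ge (hPm ▸ Finset.card_le_card (Finset.mem_Icc.1 hP).1)

theorem choose_add_eq_sum_range (x y : ℤ) (K : ℕ) :
    Ring.choose (x + y) K =
      ∑ t ∈ Finset.range (K + 1), Ring.choose x t * Ring.choose y (K - t) := by
  rw [Ring.add_choose_eq _ (Commute.all _ _), Finset.Nat.sum_antidiagonal_eq_sum_range_succ_mk]

theorem card_filter_Icc_inter_eq_sum (hA : A ∩ B ⊆ A') (hA' : A' ⊆ A ∪ B)
    (hcard : A.card + i = A'.card + j) :
    (((Finset.Icc (A ∩ B) (A ∩ A')).filter fun P => P.card + j = A.card).card : ℤ) =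
      ∑ t ∈ Finset.range (min i j + 1), Ring.choose ((A.card : ℤ) - B.card + i - j) t *
        ((Finset.Icc (A ∪ A') (A ∪ B)).filter fun P => P.card = A.card + (i - t)).card := by
  have hI : A ∩ B ⊆ A ∩ A' := Finset.subset_inter Finset.inter_subset_left hA
  have hU : A ∪ A' ⊆ A ∪ B := Finset.union_subset Finset.subset_union_left hA'
  have hAB := Finset.card_inter_add_card_union A B
  have hAA' := Finset.card_inter_add_card_union A A'
  have hI' := Finset.card_le_card hI
  have hU' := Finset.card_le_card hU
  have hAU := Finset.card_le_card (Finset.subset_union_left : A ⊆ A ∪ A')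
  have hAU' := Finset.card_le_card (Finset.subset_union_right : A' ⊆ A ∪ A')
  obtain hlt | ⟨K, hK⟩ := (lt_or_ge (A.card + i) (A ∪ A').card).imp_right Nat.exists_eq_add_of_le
  · rw [Finset.sum_eq_zero fun t ht => ?_, Nat.cast_eq_zero, Finset.card_eq_zero,
      Finset.filter_eq_empty_iff]
    · intro P hP
      have hP' := Finset.card_le_card (Finset.mem_Icc.1 hP).2
      omega
    · rw [Finset.mem_range] at ht
      rw [card_filter_Icc_card_eq_zero (by omega), Nat.cast_zero, mul_zero]
  · have hlower : ((Finset.Icc (A ∩ B) (A ∩ A')).filter fun P => P.card + j = A.card).card =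
        ((A ∩ A').card - (A ∩ B).card).choose K := by
      rw [← card_filter_Icc_card_add_eq hI]
      exact congrArg Finset.card (Finset.filter_congr fun P _ => by omega)
    have hupper : ∀ t ≤ K, ((Finset.Icc (A ∪ A') (A ∪ B)).filter fun P =>
        P.card = A.card + (i - t)).card = ((A ∪ B).card - (A ∪ A').card).choose (K - t) := by
      intro t ht
      rw [← card_filter_Icc_card_eq_add hU]
      exact congrArg Finset.card (Finset.filter_congr fun P _ => by omega)
    have hsum : (((A ∩ A').card - (A ∩ B).card : ℕ) : ℤ) =
        ((A.card : ℤ) - B.card + i - j) + ((A ∪ B).card - (A ∪ A').card : ℕ) := by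
      omega
    rw [hlower, ← Ring.choose_natCast, hsum, choose_add_eq_sum_range]
    refine Finset.sum_subset_zero_on_sdiff (Finset.range_subset_range.2 (by omega)) (fun t ht => ?_)
      fun t ht => ?_
    · rw [Finset.mem_sdiff, Finset.mem_range, Finset.mem_range] at ht
      rw [card_filter_Icc_card_eq_zero (by omega), Nat.cast_zero, mul_zero]
    · rw [hupper t (Nat.lt_succ_iff.1 (Finset.mem_range.1 ht)), Ring.choose_natCast]

/-- The pair of sets `(A', B')` arises from `(A, B)` by moving `r` elements from the first set to
the second one: this is what a rung labelled `r` does to the labels of its two uprights. -/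
structure Moves (r : ℕ) (A B A' B' : Finset α) : Prop where
  subset : A' ⊆ A
  inter_eq : A ∩ B = A' ∩ B'
  union_eq : A ∪ B = A' ∪ B'
  card_eq : A.card = A'.card + r

instance : Decidable (Moves r A B A' B') :=
  decidable_of_iff (A' ⊆ A ∧ A ∩ B = A' ∩ B' ∧ A ∪ B = A' ∪ B' ∧ A.card = A'.card + r)
    ⟨fun ⟨h, hI, hU, hc⟩ => ⟨h, hI, hU, hc⟩, fun ⟨h, hI, hU, hc⟩ => ⟨h, hI, hU, hc⟩⟩

theorem Moves.symm (h : Moves r A B A' B') : Moves r B' A' B A := by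
  obtain ⟨hsub, hI, hU, hcard⟩ := h
  have hcard' := Finset.card_inter_add_card_union A B
  rw [hI, hU, Finset.card_inter_add_card_union] at hcard'
  refine ⟨fun x hx => ?_, by rw [Finset.inter_comm, ← hI, Finset.inter_comm],
    by rw [Finset.union_comm, ← hU, Finset.union_comm], by omega⟩
  have hxU : x ∈ A' ∪ B' := hU ▸ Finset.mem_union_right A hx
  refine (Finset.mem_union.1 hxU).elim (fun hxA' => ?_) _root_.id
  have hxI : x ∈ A' ∩ B' := hI ▸ Finset.mem_inter.2 ⟨hsub hxA', hx⟩
  exact (Finset.mem_inter.1 hxI).2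

theorem moves_comm : Moves r A B A' B' ↔ Moves r B' A' B A := ⟨Moves.symm, Moves.symm⟩

theorem inter_eq_and_union_eq_iff (hI : A ∩ B ⊆ P) (hU : P ⊆ A ∪ B) :
    A ∩ B = P ∩ Q ∧ A ∪ B = P ∪ Q ↔ Q = A ∩ B ∪ (A ∪ B) \ P := by
  simp only [Finset.subset_iff, Finset.mem_inter, Finset.mem_union] at hI hU
  simp only [Finset.ext_iff, Finset.mem_inter, Finset.mem_union, Finset.mem_sdiff, ← forall_and]
  refine forall_congr' fun x => ?_
  have hxI := @hI x
  have hxU := @hU x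
  tauto

theorem moves_and_moves_iff_of_below (hI : A ∩ B = A' ∩ B') (hU : A ∪ B = A' ∪ B')
    (hcard : A.card + i = A'.card + j) : Moves j A B P Q ∧ Moves i A' B' P Q ↔
      P ∈ (Finset.Icc (A ∩ B) (A ∩ A')).filter (fun P => P.card + j = A.card) ∧
        Q = A ∩ B ∪ (A ∪ B) \ P := by
  rw [Finset.mem_filter, Finset.mem_Icc]
  constructor
  · rintro ⟨⟨hP, hPI, hPU, hc⟩, hP', -, -, -⟩
    have hIP : A ∩ B ⊆ P := hPI ▸ Finset.inter_subset_left
    exact ⟨⟨⟨hIP, Finset.subset_inter hP hP'⟩, hc.symm⟩, (inter_eq_and_union_eq_iff hIP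
      (hP.trans Finset.subset_union_left)).1 ⟨hPI, hPU⟩⟩
  · rintro ⟨⟨⟨hIP, hP⟩, hc⟩, hQ⟩
    rw [Finset.subset_inter_iff] at hP
    obtain ⟨hPI, hPU⟩ := (inter_eq_and_union_eq_iff hIP
      (hP.1.trans Finset.subset_union_left)).2 hQ
    exact ⟨⟨hP.1, hPI, hPU, hc.symm⟩, hP.2, hI ▸ hPI, hU ▸ hPU, by omega⟩

theorem moves_and_moves_iff_of_above (hI : A ∩ B = A' ∩ B') (hU : A ∪ B = A' ∪ B')
    (hcard : A.card + i = A'.card + j) : Moves i P Q A B ∧ Moves j P Q A' B' ↔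
      P ∈ (Finset.Icc (A ∪ A') (A ∪ B)).filter (fun P => P.card = A.card + i) ∧
        Q = A ∩ B ∪ (A ∪ B) \ P := by
  rw [Finset.mem_filter, Finset.mem_Icc]
  constructor
  · rintro ⟨⟨hP, hPI, hPU, hc⟩, hP', -, -, -⟩
    have hPU' : P ⊆ A ∪ B := hPU ▸ Finset.subset_union_left
    exact ⟨⟨⟨Finset.union_subset hP hP', hPU'⟩, hc⟩, (inter_eq_and_union_eq_iff
      (Finset.inter_subset_left.trans hP) hPU').1 ⟨hPI.symm, hPU.symm⟩⟩
  · rintro ⟨⟨⟨hP, hPU'⟩, hc⟩, hQ⟩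
    rw [Finset.union_subset_iff] at hP
    obtain ⟨hPI, hPU⟩ := (inter_eq_and_union_eq_iff (Finset.inter_subset_left.trans hP.1)
      hPU').2 hQ
    exact ⟨⟨hP.1, hPI.symm, hPU.symm, hc⟩, hP.2, hPI.symm.trans hI, hPU.symm.trans hU, by omega⟩

end Counting

/-! ## Rungs and the square switch relations -/

section Rungs

variable {α : Type*} [DecidableEq α] {A B A' B' P Q R : Finset α} {i j r : ℕ}

theorem split_left_merge_right_iff : ((Disjoint P Q ∧ P ∪ Q = A) ∧ B = R) ∧ P = A' ∧ Disjoint Q R ∧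
    Q ∪ R = B' ↔ (P = A' ∧ Q = A \ A' ∧ R = B) ∧ A' ⊆ A ∧ A ∩ B = A' ∩ B' ∧ A ∪ B = A' ∪ B' := by
  simp only [Finset.disjoint_left, Finset.ext_iff, Finset.subset_iff, Finset.mem_inter,
    Finset.mem_union, Finset.mem_sdiff, ← forall_and]
  exact forall_congr' fun x => by grind

/-- The matrix of a rung labelled `r` that ascends from the left upright to the right one. -/
def rungMatrix (k : Type*) [Zero k] [One k] (r : ℕ) : List (Finset α) → List (Finset α) → k
  | [A, B], [A', B'] => if Moves r A B A' B' then 1 else 0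
  | _, _ => 0

theorem sum_sum_moves_eq_sum [Fintype α] {R : Type*} [Ring R] (hI : A ∩ B = A' ∩ B')
    (hU : A ∪ B = A' ∪ B') (hcard : A.card + i = A'.card + j) :
    ∑ P ∈ Finset.powersetCard (A.card - j) Finset.univ,
      ∑ Q ∈ Finset.powersetCard (B.card + j) Finset.univ,
        (if Moves j A B P Q ∧ Moves i A' B' P Q then (1 : R) else 0) =
    ∑ t ∈ Finset.range (min i j + 1), ((Ring.choose ((A.card : ℤ) - B.card + i - j) t : ℤ) : R) *
      ∑ P ∈ Finset.powersetCard (A.card + (i - t)) Finset.univ,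
        ∑ Q ∈ Finset.powersetCard (B.card - (i - t)) Finset.univ,
          if Moves (i - t) P Q A B ∧ Moves (j - t) P Q A' B' then 1 else 0 := by
  have hbelow := sum_sum_indicator_eq_card (R := R) (fun P => A ∩ B ∪ (A ∪ B) \ P)
    (fun P Q => moves_and_moves_iff_of_below hI hU hcard (P := P) (Q := Q))
    (S := Finset.powersetCard (A.card - j) Finset.univ)
    (T := Finset.powersetCard (B.card + j) Finset.univ) fun P Q h => by
      have hP := h.1.card_eq
      have hQ := h.1.symm.card_eq
      rw [Finset.mem_powersetCard_univ, Finset.mem_powersetCard_univ]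
      omega
  rw [hbelow, ← Int.cast_natCast, card_filter_Icc_inter_eq_sum (hI ▸ Finset.inter_subset_left)
    (hU ▸ Finset.subset_union_left) hcard, Int.cast_sum]
  refine Finset.sum_congr rfl fun t ht => ?_
  have htij : t ≤ i ∧ t ≤ j := le_min_iff.1 (Finset.mem_range_succ_iff.1 ht)
  rw [Int.cast_mul, Int.cast_natCast]
  refine congrArg _ (sum_sum_indicator_eq_card (fun P => A ∩ B ∪ (A ∪ B) \ P)
    (fun P Q => moves_and_moves_iff_of_above hI hU (by omega)) fun P Q h => ?_).symm
  have hP := h.1.card_eq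
  have hQ := h.1.symm.card_eq
  rw [Finset.mem_powersetCard_univ, Finset.mem_powersetCard_univ]
  omega

theorem sum_sum_moves_comm {R : Type*} [NonAssocSemiring R] {S T : Finset (Finset α)} :
    ∑ P ∈ S, ∑ Q ∈ T, (if Moves i P Q A B ∧ Moves j P Q A' B' then (1 : R) else 0) =
      ∑ Q ∈ T, ∑ P ∈ S, if Moves i B A Q P ∧ Moves j B' A' Q P then 1 else 0 := by
  rw [Finset.sum_comm]
  exact Finset.sum_congr rfl fun Q _ => Finset.sum_congr rfl fun P _ =>
    if_congr (and_congr moves_comm moves_comm) rfl rfl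

theorem totalWeight_pair_eq_iff {n : ℕ} {A B A' B' : Finset (Fin n)}
    (h : A.card + B.card = A'.card + B'.card) :
    totalWeight [A, B] = totalWeight [A', B'] ↔ A ∩ B = A' ∩ B' ∧ A ∪ B = A' ∪ B' := by
  have hcover := totalWeight_eq_iff_coverCount_eq (s := [A, B]) (t := [A', B']) (by simpa using h)
  simp only [hcover, coverCount_cons, coverCount_nil, Finset.ext_iff, Finset.mem_inter,
    Finset.mem_union, ← forall_and]
  exact forall_congr' fun i => by grind

end Rungs

namespace PreWeb

variable {k : Type u} [Field k] {n m l m₁ l₁ m' l' i j : ℕ}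

theorem represents_rungRight (r : ℕ) (hm : m ≤ n) (hl : l ≤ n) :
    Represents [m, l] [m', l'] (rungRight k n m l m' l' r).eval (rungMatrix k r) := by
  unfold rungRight
  split_ifs with h
  · obtain ⟨rfl, rfl⟩ := h
    have hsplit : Represents [m' + r, l] [m', r, l] _ _ :=
      represents_tensor (k := k) (n := n) (represents_splitNat m' r) (represents_id_strand l)
    have hmerge : Represents [m', r, l] [m', r + l] _ _ :=
      represents_tensor (k := k) (n := n) (represents_id_strand m') (represents_mergeNat r l)
    refine represents_cast _ _ (((represents_cast rfl _ hsplit).comp hmerge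
      (by simp only [List.forall_mem_cons]; grind)).congr fun s t hs ht => ?_)
    obtain ⟨A, B, rfl, hA, hB⟩ := exists_eq_pair_of_map_card hs
    obtain ⟨A', B', rfl, hA', hB'⟩ := exists_eq_pair_of_map_card ht
    refine sum_eq_indicator [A', A \ A', B] _ (fun v hv => ?_) fun h => ?_
    · obtain ⟨P, Q, R, rfl, -⟩ := exists_eq_triple_of_map_card (mem_ofCards.1 hv)
      have hmoves : Moves r A B A' B' ↔ A' ⊆ A ∧ A ∩ B = A' ∩ B' ∧ A ∪ B = A' ∪ B' :=
        ⟨fun h => ⟨h.subset, h.inter_eq, h.union_eq⟩,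
          fun h => ⟨h.1, h.2.1, h.2.2, by omega⟩⟩
      simp only [List.length_cons, List.length_nil, zero_add, Nat.reduceAdd, List.take_succ_cons,
        List.take_zero, List.drop_succ_cons, List.drop_zero, mergeMatrix, indicator_mul_indicator,
        List.cons.injEq, and_true, split_left_merge_right_iff, hmoves]
    · have hcard := Finset.card_sdiff_of_subset h.subset
      simp only [mem_ofCards, List.map_cons, List.map_nil, List.cons.injEq, and_true]
      omega
  · refine (Represents.zero (reduceSeq_strand_append_strand m l)
      (reduceSeq_strand_append_strand m' l')).congr fun s t hs ht => ?_
    obtain ⟨A, B, rfl, hA, hB⟩ := exists_eq_pair_of_map_card hs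
    obtain ⟨A', B', rfl, hA', hB'⟩ := exists_eq_pair_of_map_card ht
    refine (if_neg fun hmoves => h ?_).symm
    have hcard := hmoves.card_eq
    have hcard' := hmoves.symm.card_eq
    omega

theorem represents_rungLeft (r : ℕ) (hm' : m' ≤ n) (hl' : l' ≤ n) :
    Represents [m, l] [m', l'] (rungLeft k n m l m' l' r).eval fun s t => rungMatrix k r t s := by
  rw [← reflect_rungRight]
  exact represents_reflect (represents_rungRight r hm' hl')

theorem eval_rungRight_eq_zero (r : ℕ) (h : n < l') : (rungRight k n m l m' l' r).eval = 0 := by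
  unfold rungRight
  split_ifs with hr
  · obtain ⟨rfl, rfl⟩ := hr
    simp only [mergeNat, dif_neg (not_le.2 h), eval_cast, eval, GPA.tensorHomOf_zero,
      Limits.comp_zero, Limits.zero_comp]
  · rfl

theorem eval_rungLeft_eq_zero (r : ℕ) (h : n < m') : (rungLeft k n m l m' l' r).eval = 0 := by
  unfold rungLeft
  split_ifs with hr
  · obtain ⟨rfl, rfl⟩ := hr
    simp only [mergeNat, dif_neg (not_le.2 h), eval_cast, eval, GPA.zero_tensorHomOf,
      Limits.comp_zero, Limits.zero_comp]
  · rfl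

theorem represents_rungRight_rungLeft (r r' : ℕ) (hm : m ≤ n) (hl : l ≤ n) (hm₁ : m₁ ≤ n)
    (hm' : m' ≤ n) (hl' : l' ≤ n) :
    Represents [m, l] [m', l']
      (comp (rungRight k n m l m₁ l₁ r) (rungLeft k n m₁ l₁ m' l' r')).eval fun s t =>
        ∑ P ∈ Finset.powersetCard m₁ Finset.univ, ∑ Q ∈ Finset.powersetCard l₁ Finset.univ,
          rungMatrix k r s [P, Q] * rungMatrix k r' t [P, Q] := by
  obtain hl₁ | hl₁ := le_or_gt l₁ n
  · refine ((represents_rungRight r hm hl).comp (represents_rungLeft r' hm' hl') ?_).congr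
      fun s t _ _ => ?_
    · simp [hm₁, hl₁]
    · simp only [sum_ofCards_cons, sum_ofCards_nil]
  · rw [eval, eval_rungRight_eq_zero r hl₁, Limits.zero_comp,
      Finset.powersetCard_eq_empty (n := l₁) |>.2 (by simpa using hl₁)]
    simp only [Finset.sum_empty, Finset.sum_const_zero]
    exact Represents.zero (reduceSeq_strand_append_strand m l)
      (reduceSeq_strand_append_strand m' l')

theorem represents_rungLeft_rungRight (r r' : ℕ) (hl₁ : l₁ ≤ n) :
    Represents [m, l] [m', l']
      (comp (rungLeft k n m l m₁ l₁ r) (rungRight k n m₁ l₁ m' l' r')).eval fun s t =>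
        ∑ P ∈ Finset.powersetCard m₁ Finset.univ, ∑ Q ∈ Finset.powersetCard l₁ Finset.univ,
          rungMatrix k r [P, Q] s * rungMatrix k r' [P, Q] t := by
  obtain hm₁ | hm₁ := le_or_gt m₁ n
  · refine ((represents_rungLeft r hm₁ hl₁).comp (represents_rungRight r' hm₁ hl₁) ?_).congr
      fun s t _ _ => ?_
    · simp [hm₁, hl₁]
    · simp only [sum_ofCards_cons, sum_ofCards_nil]
  · rw [eval, eval_rungLeft_eq_zero r hm₁, Limits.zero_comp,
      Finset.powersetCard_eq_empty.2 (by simpa using hm₁)]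
    simp only [Finset.sum_empty]
    exact Represents.zero (reduceSeq_strand_append_strand m l)
      (reduceSeq_strand_append_strand m' l')

theorem eval_square_switch_right (hm : m ≤ n) (hl : l ≤ n) (hm' : m' ≤ n) (hl' : l' ≤ n)
    (h₁ : m + i = m' + j) (h₂ : l + j = l' + i) :
    (comp (rungRight k n m l (m - j) (l + j) j) (rungLeft k n (m - j) (l + j) m' l' i)).eval =
    (PreWeb.sum (fun t => smul (binom k ((m : ℤ) - l + i - j) t)
      (comp (rungLeft k n m l (m + (i - t)) (l - (i - t)) (i - t))
        (rungRight k n (m + (i - t)) (l - (i - t)) m' l' (j - t)))) (min i j + 1)).eval := by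
  refine (represents_rungRight_rungLeft j i hm hl (by omega) hm' hl').hom_eq
    (represents_sum (reduceSeq_strand_append_strand m l) (reduceSeq_strand_append_strand m' l') _
      fun t _ => (represents_rungLeft_rungRight (i - t) (j - t) (by omega)).smul _)
    (by simp [hm, hl]) (by simp [hm', hl']) fun s t hs ht hw => ?_
  obtain ⟨A, B, rfl, rfl, rfl⟩ := exists_eq_pair_of_map_card hs
  obtain ⟨A', B', rfl, rfl, rfl⟩ := exists_eq_pair_of_map_card ht
  obtain ⟨hI, hU⟩ := (totalWeight_pair_eq_iff (by omega)).1 hw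
  simp only [rungMatrix, indicator_mul_indicator]
  exact sum_sum_moves_eq_sum hI hU h₁

theorem eval_square_switch_left (hm : m ≤ n) (hl : l ≤ n) (hm' : m' ≤ n) (hl' : l' ≤ n)
    (h₁ : m + j = m' + i) (h₂ : l + i = l' + j) :
    (comp (rungLeft k n m l (m + j) (l - j) j) (rungRight k n (m + j) (l - j) m' l' i)).eval =
    (PreWeb.sum (fun t => smul (binom k ((l : ℤ) - m + i - j) t)
      (comp (rungRight k n m l (m - (i - t)) (l + (i - t)) (i - t))
        (rungLeft k n (m - (i - t)) (l + (i - t)) m' l' (j - t)))) (min i j + 1)).eval := by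
  refine (represents_rungLeft_rungRight j i (by omega)).hom_eq
    (represents_sum (reduceSeq_strand_append_strand m l) (reduceSeq_strand_append_strand m' l') _
      fun t _ => (represents_rungRight_rungLeft (i - t) (j - t) hm hl (by omega) hm' hl').smul _)
    (by simp [hm, hl]) (by simp [hm', hl']) fun s t hs ht hw => ?_
  obtain ⟨A, B, rfl, rfl, rfl⟩ := exists_eq_pair_of_map_card hs
  obtain ⟨A', B', rfl, rfl, rfl⟩ := exists_eq_pair_of_map_card ht
  obtain ⟨hI, hU⟩ := (totalWeight_pair_eq_iff (by omega)).1 hw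
  rw [Finset.inter_comm, Finset.inter_comm A'] at hI
  rw [Finset.union_comm, Finset.union_comm A'] at hU
  simp only [rungMatrix, indicator_mul_indicator]
  rw [sum_sum_moves_comm, sum_sum_moves_eq_sum hI hU h₂]
  exact Finset.sum_congr rfl fun t _ => congrArg _ sum_sum_moves_comm

end PreWeb

/-! ## The remaining relations -/

section Relations

variable {α : Type*} [DecidableEq α] {A B C D P Q R : Finset α}

theorem merge_left_merge_iff : ((Disjoint A B ∧ A ∪ B = P) ∧ C = Q) ∧ Disjoint P Q ∧ P ∪ Q = D ↔
    (P = A ∪ B ∧ Q = C) ∧ Disjoint A B ∧ Disjoint (A ∪ B) C ∧ A ∪ B ∪ C = D := by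
  constructor
  · rintro ⟨⟨⟨hAB, rfl⟩, rfl⟩, hC, rfl⟩
    exact ⟨⟨rfl, rfl⟩, hAB, hC, rfl⟩
  · rintro ⟨⟨rfl, rfl⟩, hAB, hC, rfl⟩
    exact ⟨⟨⟨hAB, rfl⟩, rfl⟩, hC, rfl⟩

theorem merge_right_merge_iff : (A = P ∧ Disjoint B C ∧ B ∪ C = Q) ∧ Disjoint P Q ∧ P ∪ Q = D ↔
    (P = A ∧ Q = B ∪ C) ∧ Disjoint A B ∧ Disjoint (A ∪ B) C ∧ A ∪ B ∪ C = D := by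
  rw [Finset.union_assoc]
  constructor
  · rintro ⟨⟨rfl, hBC, rfl⟩, hA, rfl⟩
    rw [Finset.disjoint_union_right] at hA
    exact ⟨⟨rfl, rfl⟩, hA.1, Finset.disjoint_union_left.2 ⟨hA.2, hBC⟩, rfl⟩
  · rintro ⟨⟨rfl, rfl⟩, hAB, hC, rfl⟩
    rw [Finset.disjoint_union_left] at hC
    exact ⟨⟨rfl, hC.2, rfl⟩, Finset.disjoint_union_right.2 ⟨hAB, hC.1⟩, rfl⟩

theorem eq_compl_of_disjoint [Fintype α] (h : Disjoint A B)
    (hcard : A.card + B.card = Fintype.card α) : B = Aᶜ := by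
  refine Finset.eq_of_subset_of_card_le (Finset.subset_compl_iff_disjoint_left.2 h) ?_
  rw [Finset.card_compl]
  omega

theorem sum_sum_disjoint_union_eq [Fintype α] {S : Type*} [Semiring S] {i j : ℕ}
    (h : A.card = i + j) :
    ∑ P ∈ Finset.powersetCard i Finset.univ, ∑ Q ∈ Finset.powersetCard j Finset.univ,
      (if Disjoint P Q ∧ P ∪ Q = A then (1 : S) else 0) = (i + j).choose i := by
  have hiff : ∀ P Q : Finset α, P.card = i ∧ Disjoint P Q ∧ P ∪ Q = A ↔
      P ∈ Finset.powersetCard i A ∧ Q = A \ P := by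
    intro P Q
    rw [Finset.mem_powersetCard]
    constructor
    · rintro ⟨hP, hPQ, rfl⟩
      exact ⟨⟨Finset.subset_union_left, hP⟩, (Finset.union_sdiff_cancel_left hPQ).symm⟩
    · rintro ⟨⟨hPA, hP⟩, rfl⟩
      exact ⟨hP, Finset.disjoint_sdiff, Finset.union_sdiff_of_subset hPA⟩
  rw [← h, ← Finset.card_powersetCard, ← sum_sum_indicator_eq_card (A \ ·) hiff fun P Q hPQ => ?_]
  · refine Finset.sum_congr rfl fun P hP => Finset.sum_congr rfl fun Q _ => if_congr ?_ rfl rfl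
    rw [and_iff_right (Finset.mem_powersetCard_univ.1 hP)]
  · obtain ⟨hP, hdisj, rfl⟩ := hPQ
    rw [Finset.card_union_of_disjoint hdisj] at h
    rw [Finset.mem_powersetCard_univ, Finset.mem_powersetCard_univ]
    omega

/-- The matrix of a cap: the two sets at its ends are disjoint. -/
def capMatrix (k : Type*) [Zero k] [One k] : List (Finset α) → k
  | [A, B] => if Disjoint A B then 1 else 0
  | _ => 0

theorem sum_mergeMatrix_eq_capMatrix {S : Type*} [AddCommMonoid S] [One S] {n : ℕ}
    {A B : Finset (Fin n)} (h : A.card + B.card = n) :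
    ∑ v ∈ ofCards n [n], mergeMatrix S [A, B] v = capMatrix S [A, B] := by
  refine sum_eq_indicator [A ∪ B] _ (fun v hv => ?_) fun hAB => ?_
  · obtain ⟨P, rfl, -⟩ := List.map_eq_singleton_iff.1 (mem_ofCards.1 hv)
    refine if_congr ?_ rfl rfl
    rw [List.cons.injEq, and_iff_left rfl, and_comm, eq_comm]
  · rw [mem_ofCards, List.map_cons, Finset.card_union_of_disjoint hAB, h, List.map_nil]

theorem sum_snake_eq_one {S : Type*} [AddCommMonoid S] [One S] {n i j : ℕ} {A : Finset (Fin n)}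
    (hA : A.card = i) (h : i + j = n) {f : List (Finset (Fin n)) → S} (hf : ∀ P Q R,
      f [P, Q, R] = if (A = P ∧ Disjoint Q R) ∧ Disjoint P Q ∧ R = A then 1 else 0) :
    ∑ v ∈ ofCards n [i, j, i], f v = 1 := by
  refine (sum_eq_indicator [A, Aᶜ, A] True (fun v hv => ?_) fun _ => ?_).trans (if_pos trivial)
  · obtain ⟨P, Q, R, rfl, hP, hQ, -⟩ := exists_eq_triple_of_map_card (mem_ofCards.1 hv)
    rw [hf]
    simp only [List.cons.injEq, and_true]
    refine if_congr ⟨?_, ?_⟩ rfl rfl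
    · rintro ⟨⟨rfl, -⟩, hPQ, rfl⟩
      exact ⟨rfl, eq_compl_of_disjoint hPQ (by rw [Fintype.card_fin, hP, hQ, h]), rfl⟩
    · rintro ⟨rfl, rfl, rfl⟩
      exact ⟨⟨rfl, disjoint_compl_left⟩, disjoint_compl_right, rfl⟩
  · simp only [mem_ofCards, List.map_cons, List.map_nil, Finset.card_compl, Fintype.card_fin, hA,
      List.cons.injEq, and_true, true_and]
    omega

end Relations

namespace PreWeb

variable {k : Type u} [Field k] {n : ℕ}

theorem eval_merge_assoc (i j l : WebLabel n) (h : i.1 + j.1 + l.1 ≤ n) :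
    (comp (tensor (merge i j (by omega)) (id [l]) : PreWeb k n [i, j, l] [i.add j (by omega), l])
      (merge (i.add j (by omega)) l h)).eval =
    (comp (tensor (id [i]) (merge j l (by omega)) : PreWeb k n [i, j, l] [i, j.add l (by omega)])
      (cast rfl (by rw [WebLabel.add_add i j l h])
        (merge i (j.add l (by omega)) ((Nat.add_assoc _ _ _).symm.trans_le h)))).eval := by
  have hmerge_left : Represents [i.1, j.1, l.1] [i.1 + j.1, l.1] _ _ :=
    represents_tensor (represents_merge (k := k) i j (by omega)) (represents_id_label l)
  have hleft : Represents [i.1 + j.1, l.1] [i.1 + j.1 + l.1] _ _ :=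
    represents_merge (k := k) (i.add j (by omega)) l h
  have hmerge_right : Represents [i.1, j.1, l.1] [i.1, j.1 + l.1] _ _ :=
    represents_tensor (represents_id_label (k := k) i) (represents_merge j l (by omega))
  have hright : Represents [i.1, j.1 + l.1] [i.1 + (j.1 + l.1)] _ _ :=
    represents_merge (k := k) i (j.add l (by omega)) ((Nat.add_assoc _ _ _).symm.trans_le h)
  refine (hmerge_left.comp hleft (by simp; omega)).hom_eq
    (hmerge_right.comp (represents_cast rfl _ (hright.cast rfl (by rw [Nat.add_assoc])))
      (by simp; omega))
    (by simp; omega) (by simpa using h) fun s t hs ht _ => ?_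
  obtain ⟨A, B, C, rfl, hA, hB, hC⟩ := exists_eq_triple_of_map_card hs
  obtain ⟨D, rfl, -⟩ := List.map_eq_singleton_iff.1 ht
  refine (sum_eq_indicator [A ∪ B, C] (Disjoint A B ∧ Disjoint (A ∪ B) C ∧ A ∪ B ∪ C = D)
    (fun v hv => ?_) fun hABC => ?_).trans (sum_eq_indicator [A, B ∪ C] _ (fun v hv => ?_)
      fun hABC => ?_).symm
  · obtain ⟨P, Q, rfl, -⟩ := exists_eq_pair_of_map_card (mem_ofCards.1 hv)
    simp only [List.length_cons, List.length_nil, zero_add, Nat.reduceAdd, List.take_succ_cons,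
      List.take_zero, List.drop_succ_cons, List.drop_zero, mergeMatrix, indicator_mul_indicator,
      List.cons.injEq, and_true, merge_left_merge_iff]
  · simp [mem_ofCards, Finset.card_union_of_disjoint hABC.1, hA, hB, hC]
  · obtain ⟨P, Q, rfl, -⟩ := exists_eq_pair_of_map_card (mem_ofCards.1 hv)
    simp only [List.length_cons, List.length_nil, zero_add, List.take_succ_cons, List.take_zero,
      List.drop_succ_cons, List.drop_zero, mergeMatrix, indicator_mul_indicator, List.cons.injEq,
      and_true, merge_right_merge_iff]
  · have hBC := (Finset.disjoint_union_left.1 hABC.2.1).2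
    simp [mem_ofCards, Finset.card_union_of_disjoint hBC, hA, hB, hC]

theorem eval_split_assoc (i j l : WebLabel n) (h : i.1 + j.1 + l.1 ≤ n) :
    (comp (split (i.add j (by omega)) l h)
      (tensor (split i j (by omega)) (id [l]) :
        PreWeb k n [i.add j (by omega), l] [i, j, l])).eval =
    (comp (cast (by rw [WebLabel.add_add i j l h]) rfl
        (split i (j.add l (by omega)) ((Nat.add_assoc _ _ _).symm.trans_le h)))
      (tensor (id [i]) (split j l (by omega)) :
        PreWeb k n [i, j.add l (by omega)] [i, j, l])).eval := by
  have hreflect := congrArg GPA.transpose (eval_merge_assoc (k := k) i j l h)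
  rwa [← eval_reflect, ← eval_reflect, reflect, reflect, reflect_cast] at hreflect

theorem eval_bigon (i j : WebLabel n) (h : i.1 + j.1 ≤ n) :
    (comp (split (k := k) i j h) (merge i j h)).eval =
      (smul ((i.1 + j.1).choose i.1 : k) (id [i.add j h])).eval := by
  refine ((represents_split i j h).comp (represents_merge i j h) (by simp; omega)).hom_eq
    ((represents_id_label (i.add j h)).smul _) (by simpa using h) (by simpa using h)
    fun s t hs ht hw => ?_
  obtain ⟨A, rfl, hA⟩ := List.map_eq_singleton_iff.1 hs
  obtain ⟨A', rfl, hA'⟩ := List.map_eq_singleton_iff.1 ht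
  obtain rfl := eq_of_subsetWeight_eq (hA.trans hA'.symm)
    (by simpa only [totalWeight_cons, totalWeight_nil, add_zero] using hw)
  rw [if_pos rfl, mul_one, ← sum_sum_disjoint_union_eq hA]
  simp only [sum_ofCards_cons, sum_ofCards_nil, mergeMatrix, indicator_mul_indicator, and_self]

theorem eval_dot_codot (hn : 1 ≤ n) :
    (comp (dot (k := k) hn) (codot hn)).eval = (PreWeb.id (k := k) [WebLabel.top hn]).eval := by
  refine ((represents_dot hn).comp (represents_codot hn) (by simp)).hom_eq
    (represents_id_label (WebLabel.top hn)) (by simp) (by simp) fun s t hs ht _ => ?_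
  obtain ⟨A, rfl, hA⟩ := List.map_eq_singleton_iff.1 hs
  obtain ⟨B, rfl, hB⟩ := List.map_eq_singleton_iff.1 ht
  obtain rfl := (Finset.card_eq_iff_eq_univ A).1 (by rw [hA, Fintype.card_fin])
  obtain rfl := (Finset.card_eq_iff_eq_univ B).1 (by rw [hB, Fintype.card_fin])
  rw [sum_ofCards_nil, if_pos rfl, mul_one]

theorem eval_codot_dot (hn : 1 ≤ n) :
    (comp (codot (k := k) hn) (dot hn)).eval = (PreWeb.id (k := k) []).eval := by
  refine ((represents_codot hn).comp (represents_dot hn) (by simp)).hom_eq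
    (Represents.id (c := []) rfl) (by simp) (by simp) fun s t hs ht _ => ?_
  obtain rfl := List.map_eq_nil_iff.1 hs
  obtain rfl := List.map_eq_nil_iff.1 ht
  have hself := Finset.powersetCard_self (Finset.univ : Finset (Fin n))
  rw [Finset.card_univ, Fintype.card_fin] at hself
  rw [sum_ofCards_cons, hself, Finset.sum_singleton, sum_ofCards_nil, if_pos rfl, mul_one]

theorem represents_cap (i j : WebLabel n) (h : i.1 + j.1 = n) :
    Represents [i.1, j.1] [] (cap k i j h).eval fun s _ => capMatrix k s := by
  refine (((represents_merge i j h.le).cast rfl (by rw [h])).comp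
    (represents_cast _ _ (represents_dot (i.2.1.trans i.2.2))) (by simp)).congr fun s t hs _ => ?_
  obtain ⟨A, B, rfl, hA, hB⟩ := exists_eq_pair_of_map_card hs
  simp only [mul_one]
  exact sum_mergeMatrix_eq_capMatrix (by omega)

theorem represents_cup (i j : WebLabel n) (h : i.1 + j.1 = n) :
    Represents [] [i.1, j.1] (cup k i j h).eval fun _ t => capMatrix k t := by
  rw [← reflect_cap]
  exact represents_reflect (represents_cap i j h)

theorem eval_snake_left (i j : WebLabel n) (h : i.1 + j.1 = n) (h' : j.1 + i.1 = n) :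
    (id (k := k) [i]).eval =
      (comp (tensor (id [i]) (cup k j i h') : PreWeb k n [i] [i, j, i])
        (tensor (cap k i j h) (id [i]) : PreWeb k n [i, j, i] [i])).eval := by
  have hcup : Represents [i.1] [i.1, j.1, i.1] _ _ :=
    represents_tensor (represents_id_label i) (represents_cup (k := k) j i h')
  have hcap : Represents [i.1, j.1, i.1] [i.1] _ _ :=
    represents_tensor (represents_cap (k := k) i j h) (represents_id_label i)
  refine (represents_id_label i).hom_eq (hcup.comp hcap (by simp; omega)) (by simp; omega)
    (by simp; omega) fun s t hs ht hw => ?_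
  obtain ⟨A, rfl, hA⟩ := List.map_eq_singleton_iff.1 hs
  obtain ⟨A', rfl, hA'⟩ := List.map_eq_singleton_iff.1 ht
  obtain rfl := eq_of_subsetWeight_eq (hA.trans hA'.symm)
    (by simpa only [totalWeight_cons, totalWeight_nil, add_zero] using hw)
  rw [if_pos rfl]
  refine (sum_snake_eq_one hA h fun P Q R => ?_).symm
  simp only [List.length_cons, List.length_nil, zero_add, Nat.reduceAdd, List.take_succ_cons,
    List.take_zero, List.drop_succ_cons, List.drop_zero, capMatrix, indicator_mul_indicator,
    List.cons.injEq, and_true]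

theorem eval_snake_right (i j : WebLabel n) (h : i.1 + j.1 = n) (h' : j.1 + i.1 = n) :
    (id (k := k) [i]).eval =
      (comp (tensor (cup k i j h) (id [i]) : PreWeb k n [i] [i, j, i])
        (tensor (id [i]) (cap k j i h') : PreWeb k n [i, j, i] [i])).eval := by
  have hreflect := congrArg GPA.transpose (eval_snake_left (k := k) i j h h')
  simp only [← eval_reflect, reflect, reflect_cap, reflect_cup] at hreflect
  exact hreflect

theorem eval_eq_of_webRel {a b : List (WebLabel n)} {f g : PreWeb k n a b} (h : WebRel k n f g) :
    f.eval = g.eval := by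
  cases h with
  | merge_assoc i j l h => exact eval_merge_assoc i j l h
  | split_assoc i j l h => exact eval_split_assoc i j l h
  | bigon i j h => exact eval_bigon i j h
  | square_switch_right m l m' l' i j hm hl hm' hl' h₁ h₂ =>
    exact eval_square_switch_right hm hl hm' hl' h₁ h₂
  | square_switch_left m l m' l' i j hm hl hm' hl' h₁ h₂ =>
    exact eval_square_switch_left hm hl hm' hl' h₁ h₂
  | dot_codot hn => exact eval_dot_codot hn
  | codot_dot hn => exact eval_codot_dot hn
  | snake_left i j h h' => exact eval_snake_left i j h h'
  | snake_right i j h h' => exact eval_snake_right i j h h'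

end PreWeb

/-! ## The functor -/

section

variable {k : Type u} [Field k] {n : ℕ}

theorem PreWeb.eval_eq_of_webCong {a b : List (WebLabel n)} {f g : PreWeb k n a b}
    (h : WebCong k n f g) : f.eval = g.eval := by
  induction h with
  | rel h => exact eval_eq_of_webRel h
  | refl f => rfl
  | symm _ ih => exact ih.symm
  | trans _ _ ih ih' => exact ih.trans ih'
  | comp_congr _ _ ih ih' => exact congrArg₂ (· ≫ ·) ih ih'
  | tensor_congr _ _ ih ih' => exact congrArg₂ (GPA.tensorHomOf _ _) ih ih'
  | add_congr _ _ ih ih' => exact congrArg₂ (· + ·) ih ih'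
  | smul_congr r _ ih => exact congrArg (r • ·) ih
  | id_comp f => exact Category.id_comp f.eval
  | comp_id f => exact Category.comp_id f.eval
  | comp_assoc f g h => exact Category.assoc f.eval g.eval h.eval
  | add_assoc f g h => exact add_assoc f.eval g.eval h.eval
  | add_comm f g => exact add_comm f.eval g.eval
  | zero_add f => exact zero_add f.eval
  | zero_smul f => exact zero_smul k f.eval
  | one_smul f => exact one_smul k f.eval
  | mul_smul r s f => exact mul_smul r s f.eval
  | add_smul r s f => exact add_smul r s f.eval
  | smul_add r f g => exact smul_add r f.eval g.eval
  | add_comp f f' g => exact Preadditive.add_comp _ _ _ f.eval f'.eval g.eval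
  | comp_add f g g' => exact Preadditive.comp_add _ _ _ f.eval g.eval g'.eval
  | smul_comp r f g => exact Linear.smul_comp _ _ _ r f.eval g.eval
  | comp_smul r f g => exact Linear.comp_smul _ _ _ f.eval r g.eval
  | add_tensor f f' g => exact GPA.add_tensorHomOf _ _ f.eval f'.eval g.eval
  | tensor_add f g g' => exact GPA.tensorHomOf_add _ _ f.eval g.eval g'.eval
  | smul_tensor r f g => exact GPA.smul_tensorHomOf _ _ r f.eval g.eval
  | tensor_smul r f g => exact GPA.tensorHomOf_smul _ _ f.eval r g.eval
  | tensor_id a b => exact GPA.tensorHomOf_id _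
  | interchange f g f' g' => exact GPA.tensorHomOf_comp _ (mk_reduceSeq_append _ _) _ _ _ _ _
  | tensor_assoc f g h =>
    rw [eval_cast]
    exact GPA.tensorHomOf_assoc (mk_reduceSeq_append _ _) (mk_reduceSeq_append _ _)
      (mk_reduceSeq_append _ _) (mk_reduceSeq_append _ _) (mk_reduceSeq_append _ _)
      (mk_reduceSeq_append _ _) (mk_reduceSeq_append _ _) (mk_reduceSeq_append _ _)
      _ _ f.eval g.eval h.eval
  | id_nil_tensor f => exact GPA.tensorHomOf_nil_id f.eval
  | tensor_id_nil f =>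
    rw [eval_cast]
    exact GPA.tensorHomOf_id_nil (mk_reduceSeq_append _ []) (mk_reduceSeq_append _ []) _ _ f.eval

/-- The morphism of the graph planar algebra assigned to a web. -/
noncomputable def Web.eval {X Y : Web k n} (f : X ⟶ Y) : X.reduce ⟶ Y.reduce :=
  Quotient.lift (fun g : PreWeb k n X.seq Y.seq => g.eval)
    (fun _ _ h => PreWeb.eval_eq_of_webCong h) f

theorem Web.eval_comp {X Y Z : Web k n} (f : X ⟶ Y) (g : Y ⟶ Z) :
    Web.eval (f ≫ g) = Web.eval f ≫ Web.eval g := by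
  obtain ⟨f, rfl⟩ := Quotient.exists_rep f
  obtain ⟨g, rfl⟩ := Quotient.exists_rep g
  rfl

theorem Web.eval_tensorHom {X Y X' Y' : Web k n} (f : X ⟶ Y) (g : X' ⟶ Y') :
    Web.eval (Web.tensorHom f g) =
      GPA.tensorHomOf (Web.reduce_tensor X X') (Web.reduce_tensor Y Y') (Web.eval f)
        (Web.eval g) := by
  obtain ⟨f, rfl⟩ := Quotient.exists_rep f
  obtain ⟨g, rfl⟩ := Quotient.exists_rep g
  rfl

/-- The functor from webs to the graph planar algebra of the weight lattice which erases the entries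
`n` and sends every vertex to a triangle indicator map. -/
noncomputable def webFunctor (k : Type u) [Field k] (n : ℕ) : Web k n ⥤ GPA k (weightGraph n) where
  obj X := X.reduce
  map f := Web.eval f
  map_id _ := rfl
  map_comp := Web.eval_comp

instance : (webFunctor k n).Additive where
  map_add {_ _ f g} := by
    obtain ⟨f, rfl⟩ := Quotient.exists_rep f
    obtain ⟨g, rfl⟩ := Quotient.exists_rep g
    rfl

instance : (webFunctor k n).Linear k where
  map_smul f r := by
    obtain ⟨f, rfl⟩ := Quotient.exists_rep f
    rfl

section

open MonoidalCategory

theorem Web.associator_hom (X Y Z : Web k n) :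
    (α_ X Y Z).hom = eqToHom (show (X ⊗ Y) ⊗ Z = X ⊗ Y ⊗ Z from Web.tensorObj_assoc X Y Z) :=
  rfl

theorem Web.leftUnitor_hom (X : Web k n) :
    (λ_ X).hom = eqToHom (show 𝟙_ (Web k n) ⊗ X = X from Web.nil_tensorObj X) :=
  rfl

theorem Web.rightUnitor_hom (X : Web k n) :
    (ρ_ X).hom = eqToHom (show X ⊗ 𝟙_ (Web k n) = X from Web.tensorObj_nil X) :=
  rfl

theorem webFunctor_obj_tensorObj (X Y : Web k n) :
    (webFunctor k n).obj (X ⊗ Y) = (webFunctor k n).obj X ⊗ (webFunctor k n).obj Y :=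
  Web.reduce_tensor X Y

theorem webFunctor_obj_tensorUnit :
    (webFunctor k n).obj (𝟙_ (Web k n)) = 𝟙_ (GPA k (weightGraph n)) :=
  Web.reduce_unit

/-- The strict monoidal structure of the functor. -/
noncomputable def webFunctorCoreMonoidal (k : Type u) [Field k] (n : ℕ) :
    (webFunctor k n).CoreMonoidal where
  εIso := eqToIso webFunctor_obj_tensorUnit.symm
  μIso X Y := eqToIso (webFunctor_obj_tensorObj X Y).symm
  μIso_hom_natural_left f X' :=
    (GPA.tensorHom_comp_eqToHom _ (Web.reduce_tensor _ _) _ _).trans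
      (congrArg _ (Web.eval_tensorHom f (𝟙 X')).symm)
  μIso_hom_natural_right X' f :=
    (GPA.tensorHom_comp_eqToHom _ (Web.reduce_tensor _ _) _ _).trans
      (congrArg _ (Web.eval_tensorHom (𝟙 X') f).symm)
  associativity X Y Z := by
    simp only [Web.associator_hom, GPA.associator_hom, eqToIso.hom, eqToHom_map,
      eqToHom_whiskerRight, whiskerLeft_eqToHom, eqToHom_trans]
  left_unitality X := by
    simp only [Web.leftUnitor_hom, GPA.leftUnitor_hom, eqToIso.hom, eqToHom_map,
      eqToHom_whiskerRight, eqToHom_trans]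
  right_unitality X := by
    simp only [Web.rightUnitor_hom, GPA.rightUnitor_hom, eqToIso.hom, eqToHom_map,
      whiskerLeft_eqToHom, eqToHom_trans]

end

end

/-- For the `sl_n` weight lattice `Γ` and an arbitrary field `k`, sending the entries equal to `n` to
the empty sequence, the trivalent vertices to the triangle indicators, and the univalent vertices to
the indicators of the empty paths defines a `k`-linear strict monoidal functor
`Web(SL_n^-) ⥤ G(Γ)`. -/
theorem mainTheorem6 (k : Type u) [Field k] (n : ℕ) (hn : 1 ≤ n) :
    ∃ (F : Web k n ⥤ GPA k (weightGraph n)) (hobj : ∀ X : Web k n, F.obj X = X.reduce)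
      (_ : F.Additive) (_ : F.Linear k) (_ : F.Monoidal),
      Functor.LaxMonoidal.ε F = eqToHom (Web.reduce_unit.symm.trans (hobj _).symm) ∧
      (∀ X Y : Web k n, Functor.LaxMonoidal.μ F X Y =
        eqToHom (by rw [hobj, hobj, hobj, Web.reduce_tensor])) ∧
      (∀ (i j : WebLabel n) (h : i.1 + j.1 ≤ n),
        F.map (Web.ofPreWeb (.merge i j h)) =
          eqToHom (hobj _) ≫ GPA.triangle (Web.reduce ⟨[i, j]⟩) (Web.reduce ⟨[i.add j h]⟩) ≫
            eqToHom (hobj _).symm) ∧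
      (∀ (i j : WebLabel n) (h : i.1 + j.1 ≤ n),
        F.map (Web.ofPreWeb (.split i j h)) =
          eqToHom (hobj _) ≫ GPA.triangle (Web.reduce ⟨[i.add j h]⟩) (Web.reduce ⟨[i, j]⟩) ≫
            eqToHom (hobj _).symm) ∧
      F.map (Web.ofPreWeb (.dot hn)) =
        eqToHom (hobj _) ≫ GPA.triangle (Web.reduce ⟨[WebLabel.top hn]⟩) (Web.reduce ⟨[]⟩) ≫
          eqToHom (hobj _).symm ∧
      F.map (Web.ofPreWeb (.codot hn)) =
        eqToHom (hobj _) ≫ GPA.triangle (Web.reduce ⟨[]⟩) (Web.reduce ⟨[WebLabel.top hn]⟩) ≫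
          eqToHom (hobj _).symm := by
  let hF : (webFunctor k n).Monoidal := (webFunctorCoreMonoidal k n).toMonoidal
  refine ⟨webFunctor k n, fun _ => rfl, inferInstance, inferInstance, hF, rfl,
    fun _ _ => rfl, fun i j h => ?_, fun i j h => ?_, ?_, ?_⟩ <;>
  exact ((Category.id_comp _).trans (Category.comp_id _)).symm
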